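/- Let $d\ge 1$. There is a continuous function $c:(1,\infty)\to(0,\infty)$, depending only on $d$, such that the following holds for every $p\in(1,\infty)$, every $N$, all bounded domains (bounded, connected, open sets) $\Omega\subseteq\mathbb{R}^d$ and $\mathcal{P}\subseteq\mathbb{R}^N$, and every $\boldsymbol f\in L^{p'}(\mathcal{P}\times\Omega)$, where $p'=p/(p-1)$. Let $W^{1,p}(\Omega)$ be the space of functions in $L^p(\Omega)$ with distributional gradient in $L^p(\Omega)^d$, with norm $\|u\|_{L^p(\Omega)}+\|\nabla u\|_{L^p(\Omega)^d}$, let $W^{1,p}_0(\Omega)$ be the closure of $C_c^\infty(\Omega)$ in it, and let $\boldsymbol{\mathcal U}:=L^p(\mathcal{P},W^{1,p}_0(\Omega))$ be the Bochner--Lebesgue space. For $\boldsymbol p\in\mathcal{P}$, $v\in W^{1,p}_0(\Omega)$ and $\boldsymbol v\in\boldsymbol{\mathcal U}$ put $$E_{\boldsymbol p}(v):=\frac1p\int_\Omega|\nabla v|^p\,dx-\int_\Omega \boldsymbol f(\boldsymbol p,\cdot)\,v\,dx,\qquad \boldsymbol{\mathcal E}(\boldsymbol v):=\int_{\mathcal{P}}E_{\boldsymbol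 p}(\boldsymbol v(\boldsymbol p,\cdot))\,d\boldsymbol p .$$ These energies are well defined: for a.e. $\boldsymbol p\in\mathcal{P}$ the function $\boldsymbol f(\boldsymbol p,\cdot)\,v$ is integrable on $\Omega$ for all $v\in W^{1,p}_0(\Omega)$, and $\boldsymbol p\mapsto E_{\boldsymbol p}(\boldsymbol v(\boldsymbol p,\cdot))$ is integrable on $\mathcal{P}$ for all $\boldsymbol v\in\boldsymbol{\mathcal U}$. Moreover: (i) There exists a unique minimizer $\boldsymbol u^*\in\boldsymbol{\mathcal U}$ of $\boldsymbol{\mathcal E}:\boldsymbol{\mathcal U}\to\mathbb{R}$. (ii) For a.e. $\boldsymbol p\in\mathcal{P}$, the slice $\boldsymbol u^*(\boldsymbol p,\cdot)\in W^{1,p}_0(\Omega)$ is the unique minimizer of $E_{\boldsymbol p}:W^{1,p}_0(\Omega)\to\mathbb{R}$. (iii) With $F(a):=|a|^{\frac{p-2}{2}}a$ for $a\in\mathbb{R}^d$, for a.e. $\boldsymbol p\in\mathcal{P}$ and all $v\in W^{1,p}_0(\Omega)$, $$c(p)^{-1}\,\|F(\nabla v)-F(\nabla_x\boldsymbol u^*(\boldsymbol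 p,\cdot))\|_{L^2(\Omega)^d}^2\le E_{\boldsymbol p}(v)-E_{\boldsymbol p}(\boldsymbol u^*(\boldsymbol p,\cdot))\le c(p)\,\|F(\nabla v)-F(\nabla_x\boldsymbol u^*(\boldsymbol p,\cdot))\|_{L^2(\Omega)^d}^2 .$$ -/

import Mathlib

open MeasureTheory TopologicalSpace
open scoped ENNReal Distributions

noncomputable section

namespace PDirichlet

/-- `ℝ^d` with the Euclidean norm. -/
abbrev Space (d : ℕ) : Type := EuclideanSpace ℝ (Fin d)

/-- A real exponent `p > 1` is an admissible exponent for Mathlib's `Lp` spaces. -/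
instance fact_one_le_ofReal (p : ℝ) [hp : Fact (1 < p)] : Fact (1 ≤ ENNReal.ofReal p) :=
  ⟨by simpa using ENNReal.ofReal_le_ofReal hp.out.le⟩

/-- A bounded domain: a bounded, connected (in particular non-empty), open subset of `ℝ^d`. -/
def IsBoundedDomain {d : ℕ} (Ω : Opens (Space d)) : Prop :=
  IsConnected (Ω : Set (Space d)) ∧ Bornology.IsBounded (Ω : Set (Space d))

section Sobolev

variable {d : ℕ} (Ω : Opens (Space d)) (q : ℝ≥0∞)

/-- The vector field `g` is the distributional gradient of `u` on `Ω`: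
`∫_Ω u ∇φ dx = - ∫_Ω φ g dx` for all `φ ∈ C_c^∞(Ω)`. -/
def IsWeakGradient (u : Space d → ℝ) (g : Space d → Space d) : Prop :=
  ∀ φ : 𝓓(Ω, ℝ), ∫ x in Ω, u x • gradient φ x = - ∫ x in Ω, φ x • g x

variable [Fact (1 ≤ q)]

/-- `L^q(Ω) × L^q(Ω)^d` with the sum norm. -/
abbrev FunGradPair : Type :=
  WithLp 1 (Lp ℝ q (volume.restrict (Ω : Set (Space d))) ×
    Lp (Space d) q (volume.restrict (Ω : Set (Space d))))

variable {Ω q} in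
lemma integrable_smul_gradient (u : Lp ℝ q (volume.restrict (Ω : Set (Space d))))
    (φ : 𝓓(Ω, ℝ)) :
    Integrable (fun x => u x • gradient φ x) (volume.restrict (Ω : Set (Space d))) := by
  have hc : Continuous (gradient φ) := by
    unfold gradient
    exact (LinearIsometryEquiv.continuous _).comp
      (φ.contDiff.continuous_fderiv (by simp))
  have hs : HasCompactSupport (gradient φ) := by
    refine (φ.hasCompactSupport.fderiv (𝕜 := ℝ)).comp_left
      (g := (InnerProductSpace.toDual ℝ (Space d)).symm) (map_zero _)
  exact ((Lp.memLp u).locallyIntegrable Fact.out).integrable_smul_right_of_hasCompactSupport hc hs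

variable {Ω q} in
lemma integrable_test_smul (g : Lp (Space d) q (volume.restrict (Ω : Set (Space d))))
    (φ : 𝓓(Ω, ℝ)) :
    Integrable (fun x => φ x • g x) (volume.restrict (Ω : Set (Space d))) :=
  ((Lp.memLp g).locallyIntegrable Fact.out).integrable_smul_left_of_hasCompactSupport
    φ.continuous φ.hasCompactSupport

/-- The Sobolev space `W^{1,q}(Ω)`: functions in `L^q(Ω)` with distributional gradient in
`L^q(Ω)^d`. An element is stored as the pair of the function and its gradient, so that the
norm is `‖u‖_{L^q} + ‖∇u‖_{L^q}`. -/
def sobolev : Submodule ℝ (FunGradPair Ω q) where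
  carrier := {w | IsWeakGradient Ω w.fst w.snd}
  zero_mem' := by
    intro φ
    have h1 : ∫ x in Ω, ((0 : FunGradPair Ω q).fst : Space d → ℝ) x • gradient φ x
        = ∫ _ in (Ω : Set (Space d)), (0 : Space d) := by
      refine integral_congr_ae ?_
      filter_upwards [Lp.coeFn_zero ℝ q (volume.restrict (Ω : Set (Space d)))] with x hx
      rw [WithLp.zero_fst, hx, Pi.zero_apply, zero_smul]
    have h2 : ∫ x in Ω, φ x • ((0 : FunGradPair Ω q).snd : Space d → Space d) x
        = ∫ _ in (Ω : Set (Space d)), (0 : Space d) := by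
      refine integral_congr_ae ?_
      filter_upwards [Lp.coeFn_zero (Space d) q (volume.restrict (Ω : Set (Space d)))] with x hx
      rw [WithLp.zero_snd, hx, Pi.zero_apply, smul_zero]
    rw [h1, h2]; simp
  add_mem' := by
    intro a b ha hb φ
    have h1 : ∫ x in Ω, ((a + b).fst : Space d → ℝ) x • gradient φ x
        = ∫ x in Ω, (a.fst x • gradient φ x + b.fst x • gradient φ x) := by
      refine integral_congr_ae ?_
      filter_upwards [Lp.coeFn_add a.fst b.fst] with x hx
      rw [WithLp.add_fst, hx, Pi.add_apply, add_smul]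
    have h2 : ∫ x in Ω, φ x • ((a + b).snd : Space d → Space d) x
        = ∫ x in Ω, (φ x • a.snd x + φ x • b.snd x) := by
      refine integral_congr_ae ?_
      filter_upwards [Lp.coeFn_add a.snd b.snd] with x hx
      rw [WithLp.add_snd, hx, Pi.add_apply, smul_add]
    rw [h1, h2, integral_add (integrable_smul_gradient _ _) (integrable_smul_gradient _ _),
      integral_add (integrable_test_smul _ _) (integrable_test_smul _ _), ha φ, hb φ]
    abel
  smul_mem' := by
    intro c a ha φ
    have h1 : ∫ x in Ω, ((c • a).fst : Space d → ℝ) x • gradient φ x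
        = ∫ x in Ω, c • (a.fst x • gradient φ x) := by
      refine integral_congr_ae ?_
      filter_upwards [Lp.coeFn_smul c a.fst] with x hx
      simp [hx, mul_smul]
    have h2 : ∫ x in Ω, φ x • ((c • a).snd : Space d → Space d) x
        = ∫ x in Ω, c • (φ x • a.snd x) := by
      refine integral_congr_ae ?_
      filter_upwards [Lp.coeFn_smul c a.snd] with x hx
      simp [hx, smul_comm c]
    rw [h1, h2, integral_smul, integral_smul, ha φ, smul_neg]

/-- The elements `(φ, ∇φ)`, `φ ∈ C_c^∞(Ω)`, of `W^{1,q}(Ω)`. -/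
def testFunctions : Submodule ℝ (sobolev Ω q) where
  carrier := {w | ∃ φ : 𝓓(Ω, ℝ),
    w.1.fst =ᵐ[volume.restrict (Ω : Set (Space d))] φ ∧
    w.1.snd =ᵐ[volume.restrict (Ω : Set (Space d))] gradient φ}
  zero_mem' := by
    refine ⟨0, Lp.coeFn_zero ℝ q _, ?_⟩
    filter_upwards [Lp.coeFn_zero (Space d) q (volume.restrict (Ω : Set (Space d)))] with x hx
    have : (⇑(0 : 𝓓(Ω, ℝ)) : Space d → ℝ) = fun _ => 0 := rfl
    rw [Submodule.coe_zero, WithLp.zero_snd, hx, this]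
    simp [gradient]
  add_mem' := by
    rintro a b ⟨φ, h1, h2⟩ ⟨ψ, h3, h4⟩
    refine ⟨φ + ψ, ?_, ?_⟩
    · filter_upwards [Lp.coeFn_add a.1.fst b.1.fst, h1, h3] with x hx h1 h3
      rw [Submodule.coe_add, WithLp.add_fst, hx, Pi.add_apply, h1, h3]
      rfl
    · filter_upwards [Lp.coeFn_add a.1.snd b.1.snd, h2, h4] with x hx h2 h4
      have hφ : DifferentiableAt ℝ φ x := φ.contDiff.differentiable (by simp) x
      have hψ : DifferentiableAt ℝ ψ x := ψ.contDiff.differentiable (by simp) x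
      have : (⇑(φ + ψ) : Space d → ℝ) = ⇑φ + ⇑ψ := rfl
      rw [Submodule.coe_add, WithLp.add_snd, hx, Pi.add_apply, h2, h4, this]
      simp [gradient, fderiv_add hφ hψ]
  smul_mem' := by
    rintro c a ⟨φ, h1, h2⟩
    refine ⟨c • φ, ?_, ?_⟩
    · filter_upwards [Lp.coeFn_smul c a.1.fst, h1] with x hx h1
      simp [hx, h1]
    · filter_upwards [Lp.coeFn_smul c a.1.snd, h2] with x hx h2
      have hφ : DifferentiableAt ℝ φ x := φ.contDiff.differentiable (by simp) x
      have : (⇑(c • φ) : Space d → ℝ) = c • ⇑φ := rfl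
      simp [hx, h2, this, gradient, fderiv_const_smul hφ c]

/-- `W_0^{1,q}(Ω)`: the closure of `C_c^∞(Ω)` in `W^{1,q}(Ω)`. -/
def sobolevZero : Submodule ℝ (sobolev Ω q) := (testFunctions Ω q).topologicalClosure

/-- `W_0^{1,q}(Ω)` as a normed space. -/
def SobolevZero : Type := sobolevZero Ω q

instance : NormedAddCommGroup (SobolevZero Ω q) :=
  inferInstanceAs (NormedAddCommGroup (sobolevZero Ω q))

instance : NormedSpace ℝ (SobolevZero Ω q) :=
  inferInstanceAs (NormedSpace ℝ (sobolevZero Ω q))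

variable {Ω q}

/-- The function underlying an element of `W_0^{1,q}(Ω)`. -/
def SobolevZero.toFun (v : SobolevZero Ω q) : Space d → ℝ := v.1.1.fst

/-- The distributional gradient of an element of `W_0^{1,q}(Ω)`. -/
def SobolevZero.grad (v : SobolevZero Ω q) : Space d → Space d := v.1.1.snd

end Sobolev

/-- `F(a) = |a|^{(p-2)/2} a`. -/
def natF {d : ℕ} (p : ℝ) (a : Space d) : Space d := ‖a‖ ^ ((p - 2) / 2) • a

section Energy

variable {d N : ℕ} (p : ℝ) [Fact (1 < p)] (Ω : Opens (Space d)) (P : Opens (Space N))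

/-- The squared natural distance `‖F(∇v) - F(∇w)‖²_{L²(Ω)^d}`. -/
def natDistSq (v w : SobolevZero Ω (ENNReal.ofReal p)) : ℝ :=
  ∫ x in Ω, ‖natF p (v.grad x) - natF p (w.grad x)‖ ^ 2

/-- The `p`-Dirichlet energy `(1/p) ∫_Ω |∇v|^p dx - ∫_Ω g v dx` on `W_0^{1,p}(Ω)`. -/
def energy (g : Space d → ℝ) (v : SobolevZero Ω (ENNReal.ofReal p)) : ℝ :=
  (1 / p) * (∫ x in Ω, ‖v.grad x‖ ^ p) - ∫ x in Ω, g x * v.toFun x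

/-- The Bochner--Lebesgue space `L^p(P, W_0^{1,p}(Ω))`. -/
abbrev ParamSpace : Type :=
  Lp (SobolevZero Ω (ENNReal.ofReal p)) (ENNReal.ofReal p) (volume.restrict (P : Set (Space N)))

/-- The variable right-hand side energy: the integral over `P` of the energies of the slices. -/
def paramEnergy (f : Space N × Space d → ℝ) (v : ParamSpace p Ω P) : ℝ :=
  ∫ y in P, energy p Ω (fun x => f (y, x)) (v y)

end Energy

/-- `u` is a minimizer of `J`, and it is the only one. -/
def IsUniqueMinimizer {X : Type*} (J : X → ℝ) (u : X) : Prop :=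
  (∀ v, J u ≤ J v) ∧ ∀ w, (∀ v, J w ≤ J v) → w = u

end PDirichlet

end

open PDirichlet

noncomputable section

namespace PDirichlet

/-! ### Pointwise inequalities for `natF` and the Bregman distance of `|·|^p / p`. -/

section Pointwise

open Real

/-! At a minimizer `u` the first variation vanishes, so the energy gap `E(v) - E(u)` is exactly the
integral of the Bregman distance of `|·|^p / p` from `∇u` to `∇v` (`dualEnergy_sub_eq`). Claim (iii)
is therefore a pointwise statement, `bregman_bounds`: the Bregman distance is comparable to `|F(b) -
F(a)|²`. For fixed `|a|` and `|b|` both sides are affine in the cosine of the angle, so only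
parallel and opposite vectors matter; the parallel case is a refined AM-GM inequality with weights
`1/p` and `1 - 1/p`. The resulting constant does not even depend on `d`.

The same comparison with a compactness and scaling argument gives uniform convexity: a small
integrated Bregman distance forces closeness in `L^p` on bounded sets
(`exists_norm_sub_lt_of_bregmanInt`). With the Poincaré inequality this makes minimizing sequences
Cauchy, so minimizers exist without weak compactness, and it makes the solution operator `S` from
loads to minimizers norm-continuous (`exists_continuous_solution`).

For the parametric problem, the slices of `f` form a strongly measurable map into `L^{p'}(Ω)`.
Composing it with the continuous `S` yields a measurable family of slicewise minimizers, with no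
selection theorem, and coercivity puts it in `L^p(P, W_0^{1,p}(Ω))`. Integrating the slicewise
inequalities gives minimality of the integrated energy; uniqueness holds because a nonnegative gap
with zero integral vanishes a.e. -/

lemma weighted_amgm_aux_lower {θ x y : ℝ} (h0 : 0 < θ) (h1 : θ ≤ 1 / 2) (hx : 0 ≤ x)
    (hy : 0 ≤ y) :
    θ * (x - y) ^ 2 ≤ (1 - θ) * x ^ 2 + θ * y ^ 2 - x ^ (2 * (1 - θ)) * y ^ (2 * θ) := by
  -- Split the geometric mean as `(x²)^(1-2θ) (xy)^(2θ)`: plain AM-GM on `x²` and `xy` leaves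
  -- exactly `θ (x - y)²`.
  have h := geom_mean_le_arith_mean2_weighted (w₁ := 1 - 2 * θ) (w₂ := 2 * θ) (by linarith)
    (by linarith) (sq_nonneg x) (mul_nonneg hx hy) (by ring)
  have e : (x ^ 2) ^ (1 - 2 * θ) * (x * y) ^ (2 * θ) = x ^ (2 * (1 - θ)) * y ^ (2 * θ) := by
    rw [mul_rpow hx hy, ← mul_assoc, ← rpow_natCast x 2, ← rpow_mul hx,
      ← rpow_add_of_nonneg hx (by norm_num; linarith) (by linarith)]
    congr 2
    push_cast
    ring
  rw [e] at h
  nlinarith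

lemma weighted_amgm_aux_upper {θ x y : ℝ} (h0 : 0 < θ) (h1 : θ ≤ 1 / 2) (hx : 0 ≤ x)
    (hy : 0 ≤ y) :
    (1 - θ) * x ^ 2 + θ * y ^ 2 - x ^ (2 * (1 - θ)) * y ^ (2 * θ) ≤ (1 - θ) * (x - y) ^ 2 := by
  have ht : 0 < 1 - θ := by linarith
  -- Now `xy` is the geometric mean, of `y²` and of the product to be bounded from below; the
  -- weights are the ones that make the exponents match.
  have h := geom_mean_le_arith_mean2_weighted (w₁ := (1 - 2 * θ) / (2 * (1 - θ)))
    (w₂ := 1 / (2 * (1 - θ))) (div_nonneg (by linarith) (by linarith))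
    (by positivity) (sq_nonneg y)
    (mul_nonneg (rpow_nonneg hx (2 * (1 - θ))) (rpow_nonneg hy (2 * θ)))
    (by field_simp; ring)
  have e : (y ^ 2) ^ ((1 - 2 * θ) / (2 * (1 - θ))) *
      (x ^ (2 * (1 - θ)) * y ^ (2 * θ)) ^ (1 / (2 * (1 - θ))) = x * y := by
    rw [mul_rpow (rpow_nonneg hx _) (rpow_nonneg hy _), ← rpow_natCast y 2, ← rpow_mul hy,
      ← rpow_mul hx, ← rpow_mul hy, mul_left_comm,
      ← rpow_add_of_nonneg hy]
    · have e1 : 2 * (1 - θ) * (1 / (2 * (1 - θ))) = 1 := by field_simp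
      have e2 : ((2 : ℕ) : ℝ) * ((1 - 2 * θ) / (2 * (1 - θ))) + 2 * θ * (1 / (2 * (1 - θ))) = 1 := by
        push_cast
        field_simp
        ring
      rw [e1, e2, rpow_one, rpow_one]
    · exact mul_nonneg (by norm_num) (div_nonneg (by linarith) (by linarith))
    · positivity
  rw [e, div_mul_eq_mul_div, div_mul_eq_mul_div, ← add_div, le_div_iff₀ (by linarith)] at h
  nlinarith

/-- Refined weighted AM-GM inequality, lower bound. -/
lemma weighted_amgm_lower {θ x y : ℝ} (h0 : 0 < θ) (h1 : θ < 1) (hx : 0 ≤ x) (hy : 0 ≤ y) :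
    min θ (1 - θ) * (x - y) ^ 2 ≤
      (1 - θ) * x ^ 2 + θ * y ^ 2 - x ^ (2 * (1 - θ)) * y ^ (2 * θ) := by
  rcases le_total θ (1 / 2) with h | h
  · rw [min_eq_left (by linarith)]
    exact weighted_amgm_aux_lower h0 h hx hy
  · rw [min_eq_right (by linarith)]
    have := weighted_amgm_aux_lower (θ := 1 - θ) (by linarith) (by linarith) hy hx
    rw [sub_sub_cancel] at this
    linarith

/-- Refined weighted AM-GM inequality, upper bound. -/
lemma weighted_amgm_upper {θ x y : ℝ} (h0 : 0 < θ) (h1 : θ < 1) (hx : 0 ≤ x) (hy : 0 ≤ y) :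
    (1 - θ) * x ^ 2 + θ * y ^ 2 - x ^ (2 * (1 - θ)) * y ^ (2 * θ) ≤
      max θ (1 - θ) * (x - y) ^ 2 := by
  rcases le_total θ (1 / 2) with h | h
  · rw [max_eq_right (by linarith)]
    exact weighted_amgm_aux_upper h0 h hx hy
  · rw [max_eq_left (by linarith)]
    have := weighted_amgm_aux_upper (θ := 1 - θ) (by linarith) (by linarith) hy hx
    rw [sub_sub_cancel] at this
    linarith

/-- The constant in the comparison of the energy gap with the natural distance. -/
def natConst (p : ℝ) : ℝ := 2 * (p + p / (p - 1))

lemma natConst_pos {p : ℝ} (hp : 1 < p) : 0 < natConst p := by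
  have : 0 < p - 1 := by linarith
  unfold natConst
  positivity

lemma continuousOn_natConst : ContinuousOn natConst (Set.Ioi 1) := by
  unfold natConst
  refine continuousOn_const.mul (continuousOn_id.add (continuousOn_id.div ?_ ?_))
  · fun_prop
  · intro x hx
    exact (sub_pos.2 hx).ne'

/-- The numbers `p` and `p / (p - 1)` are the reciprocals of the weights `1/p` and `1 - 1/p`, so
their sum dominates both. The factor 2 in `natConst` pays for the `1/2` in `antiradial_bounds`. -/
lemma inv_natConst_le {p : ℝ} (hp : 1 < p) :
    (natConst p)⁻¹ ≤ 1 / 2 * min (1 / p) (1 - 1 / p) := by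
  have h1 : 0 < p - 1 := by linarith
  have h0 : 0 < p := by linarith
  have hd : 0 < p / (p - 1) := by positivity
  have e : 1 - 1 / p = (p / (p - 1))⁻¹ := by field_simp
  rw [natConst, mul_inv, ← one_div (2 : ℝ)]
  refine mul_le_mul_of_nonneg_left (le_min ?_ ?_) (by norm_num)
  · rw [one_div]
    exact inv_anti₀ h0 (by linarith)
  · rw [e]
    exact inv_anti₀ hd (by linarith)

lemma two_le_natConst {p : ℝ} (hp : 1 < p) : 2 ≤ natConst p := by
  have h1 : 0 < p - 1 := by linarith
  have hd : 0 < p / (p - 1) := by positivity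
  unfold natConst
  linarith

/-- The Bregman distance of `|·|^p / p`. -/
def bregman {d : ℕ} (p : ℝ) (a b : Space d) : ℝ :=
  (1 / p) * ‖b‖ ^ p - (1 / p) * ‖a‖ ^ p - ‖a‖ ^ (p - 2) * inner ℝ a (b - a)

/-- The witness `τ` is the cosine of the angle. If a vector vanishes, division by zero gives `τ =
0`, which still works. -/
lemma exists_inner_eq {d : ℕ} (a b : Space d) :
    ∃ τ : ℝ, -1 ≤ τ ∧ τ ≤ 1 ∧ inner ℝ a b = τ * (‖a‖ * ‖b‖) := by
  have h := abs_le.1 (abs_real_inner_div_norm_mul_norm_le_one a b)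
  refine ⟨_, h.1, h.2, ?_⟩
  rcases eq_or_ne (‖a‖ * ‖b‖) 0 with h0 | h0
  · rw [h0, mul_zero, ← abs_nonpos_iff, ← h0]
    exact abs_real_inner_le_norm a b
  · rw [div_mul_cancel₀ _ h0]

lemma norm_natF {d : ℕ} {p : ℝ} (hp : 1 < p) (a : Space d) : ‖natF p a‖ = ‖a‖ ^ (p / 2) := by
  rw [natF, norm_smul, norm_of_nonneg (rpow_nonneg (norm_nonneg a) _)]
  rcases eq_or_ne ‖a‖ 0 with h | h
  · rw [h, mul_zero, zero_rpow (by linarith)]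
  · rw [← rpow_add_one h]
    congr 1
    ring

lemma norm_natF_sq {d : ℕ} {p : ℝ} (hp : 1 < p) (a : Space d) : ‖natF p a‖ ^ 2 = ‖a‖ ^ p := by
  rw [norm_natF hp, ← rpow_natCast, ← rpow_mul (norm_nonneg _)]
  congr 1
  push_cast
  ring

lemma rpow_sub_one_mul {p r : ℝ} (hp : 1 < p) (hr : 0 ≤ r) :
    r ^ (p - 1) = r ^ (p - 2) * r := by
  rcases eq_or_lt_of_le hr with h | h
  · rw [← h, mul_zero, zero_rpow (by linarith)]
  · rw [← rpow_add_one h.ne']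
    congr 1
    ring

/-- At fixed norms this quantity and the Bregman distance (`bregman_eq`) are affine in the cosine
`τ`. Writing both as the same convex combination of their values at `τ = 1` and `τ = -1` reduces
their comparison to scalars. -/
lemma norm_natF_sub_sq {d : ℕ} {p τ : ℝ} (hp : 1 < p) (a b : Space d)
    (h : inner ℝ a b = τ * (‖a‖ * ‖b‖)) :
    ‖natF p b - natF p a‖ ^ 2 =
      (1 + τ) / 2 * (‖a‖ ^ (p / 2) - ‖b‖ ^ (p / 2)) ^ 2 +
        (1 - τ) / 2 * (‖a‖ ^ (p / 2) + ‖b‖ ^ (p / 2)) ^ 2 := by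
  have e : inner ℝ (natF p b) (natF p a) = τ * (‖a‖ ^ (p / 2) * ‖b‖ ^ (p / 2)) := by
    rw [← norm_natF hp a, ← norm_natF hp b]
    unfold natF
    rw [real_inner_smul_left, real_inner_smul_right, real_inner_comm, h, norm_smul, norm_smul,
      norm_of_nonneg (rpow_nonneg (norm_nonneg a) _),
      norm_of_nonneg (rpow_nonneg (norm_nonneg b) _)]
    ring
  rw [norm_sub_sq_real, e, norm_natF hp, norm_natF hp]
  ring

lemma bregman_eq {d : ℕ} {p τ : ℝ} (hp : 1 < p) (a b : Space d)
    (h : inner ℝ a b = τ * (‖a‖ * ‖b‖)) :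
    bregman p a b = (1 + τ) / 2 *
        ((1 - 1 / p) * ‖a‖ ^ p + 1 / p * ‖b‖ ^ p - ‖a‖ ^ (p - 1) * ‖b‖) +
      (1 - τ) / 2 *
        ((1 - 1 / p) * ‖a‖ ^ p + 1 / p * ‖b‖ ^ p + ‖a‖ ^ (p - 1) * ‖b‖) := by
  have e : ‖a‖ ^ p = ‖a‖ ^ (p - 2) * ‖a‖ ^ 2 := by
    have h1 := rpow_sub_one_mul (p := p) hp (norm_nonneg a)
    have h2 := rpow_sub_one_mul (p := p + 1) (by linarith) (norm_nonneg a)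
    rw [add_sub_cancel_right, show p + 1 - 2 = p - 1 by ring, h1] at h2
    rw [h2]
    ring
  have e' := rpow_sub_one_mul (p := p) hp (norm_nonneg a)
  rw [bregman, inner_sub_right, h, real_inner_self_eq_norm_sq, e', e]
  ring

/-- The case `τ = 1`: refined AM-GM with `θ = 1/p`, `x = r^(p/2)`, `y = s^(p/2)`. -/
lemma radial_bounds {p r s : ℝ} (hp : 1 < p) (hr : 0 ≤ r) (hs : 0 ≤ s) :
    min (1 / p) (1 - 1 / p) * (r ^ (p / 2) - s ^ (p / 2)) ^ 2 ≤
        (1 - 1 / p) * r ^ p + 1 / p * s ^ p - r ^ (p - 1) * s ∧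
      (1 - 1 / p) * r ^ p + 1 / p * s ^ p - r ^ (p - 1) * s ≤
        max (1 / p) (1 - 1 / p) * (r ^ (p / 2) - s ^ (p / 2)) ^ 2 := by
  have h0 : 0 < 1 / p := by positivity
  have h1 : 1 / p < 1 := by rw [div_lt_one (by linarith)]; exact hp
  have hr' := rpow_nonneg hr (p / 2)
  have hs' := rpow_nonneg hs (p / 2)
  have e1 : ∀ x : ℝ, 0 ≤ x → (x ^ (p / 2)) ^ 2 = x ^ p := fun x hx => by
    rw [← rpow_natCast, ← rpow_mul hx]
    congr 1
    push_cast
    ring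
  have e2 : (r ^ (p / 2)) ^ (2 * (1 - 1 / p)) = r ^ (p - 1) := by
    rw [← rpow_mul hr]
    congr 1
    field_simp
  have e3 : (s ^ (p / 2)) ^ (2 * (1 / p)) = s := by
    rw [← rpow_mul hs]
    have : p / 2 * (2 * (1 / p)) = 1 := by field_simp
    rw [this, rpow_one]
  have hl := weighted_amgm_lower h0 h1 hr' hs'
  have hu := weighted_amgm_upper h0 h1 hr' hs'
  rw [e1 r hr, e1 s hs, e2, e3] at hl hu
  exact ⟨hl, hu⟩

/-- The case `τ = -1`: nothing cancels, and everything is comparable to `x² + y²` with `x =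
r^(p/2)`, `y = s^(p/2)`. The mixed term is at most the other two by the radial lower bound. -/
lemma antiradial_bounds {p r s : ℝ} (hp : 1 < p) (hr : 0 ≤ r) (hs : 0 ≤ s) :
    1 / 2 * min (1 / p) (1 - 1 / p) * (r ^ (p / 2) + s ^ (p / 2)) ^ 2 ≤
        (1 - 1 / p) * r ^ p + 1 / p * s ^ p + r ^ (p - 1) * s ∧
      (1 - 1 / p) * r ^ p + 1 / p * s ^ p + r ^ (p - 1) * s ≤
        2 * (r ^ (p / 2) + s ^ (p / 2)) ^ 2 := by
  have h0 : 0 < 1 / p := by positivity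
  have h1 : 1 / p < 1 := by rw [div_lt_one (by linarith)]; exact hp
  obtain ⟨hl, -⟩ := radial_bounds hp hr hs
  have hm : 0 ≤ min (1 / p) (1 - 1 / p) := le_min h0.le (by linarith)
  have e1 : ∀ x : ℝ, 0 ≤ x → (x ^ (p / 2)) ^ 2 = x ^ p := fun x hx => by
    rw [← rpow_natCast, ← rpow_mul hx]
    congr 1
    push_cast
    ring
  have hrp := e1 r hr
  have hsp := e1 s hs
  have hr' := rpow_nonneg hr (p / 2)
  have hs' := rpow_nonneg hs (p / 2)
  have hc : 0 ≤ r ^ (p - 1) * s := mul_nonneg (rpow_nonneg hr _) hs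
  rw [← hrp, ← hsp] at hl ⊢
  set x := r ^ (p / 2)
  set y := s ^ (p / 2)
  have hxy := mul_nonneg hr' hs'
  have ha : (1 - 1 / p) * x ^ 2 ≤ 1 * x ^ 2 :=
    mul_le_mul_of_nonneg_right (by linarith) (sq_nonneg x)
  have hb : 1 / p * y ^ 2 ≤ 1 * y ^ 2 := mul_le_mul_of_nonneg_right h1.le (sq_nonneg y)
  have ha' : min (1 / p) (1 - 1 / p) * x ^ 2 ≤ (1 - 1 / p) * x ^ 2 :=
    mul_le_mul_of_nonneg_right (min_le_right _ _) (sq_nonneg x)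
  have hb' : min (1 / p) (1 - 1 / p) * y ^ 2 ≤ 1 / p * y ^ 2 :=
    mul_le_mul_of_nonneg_right (min_le_left _ _) (sq_nonneg y)
  constructor
  · nlinarith [mul_nonneg hm (sq_nonneg (x - y))]
  · nlinarith

/-- The Bregman distance of `|·|^p / p` is comparable to `|F(b) - F(a)|²`. -/
lemma bregman_bounds {d : ℕ} {p : ℝ} (hp : 1 < p) (a b : Space d) :
    (natConst p)⁻¹ * ‖natF p b - natF p a‖ ^ 2 ≤ bregman p a b ∧
      bregman p a b ≤ natConst p * ‖natF p b - natF p a‖ ^ 2 := by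
  obtain ⟨τ, h1, h2, h⟩ := exists_inner_eq a b
  rw [norm_natF_sub_sq hp a b h, bregman_eq hp a b h]
  obtain ⟨l1, u1⟩ := radial_bounds hp (norm_nonneg a) (norm_nonneg b)
  obtain ⟨l2, u2⟩ := antiradial_bounds hp (norm_nonneg a) (norm_nonneg b)
  have hc := inv_natConst_le hp
  have hc2 := two_le_natConst hp
  have h0 : 0 < 1 / p := by positivity
  have h1' : 1 / p < 1 := by rw [div_lt_one (by linarith)]; exact hp
  have hm : 0 ≤ min (1 / p) (1 - 1 / p) := le_min h0.le (by linarith)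
  have hM : max (1 / p) (1 - 1 / p) ≤ natConst p := (max_le h1'.le (by linarith)).trans
    (by linarith : (1 : ℝ) ≤ natConst p)
  have L1 := (mul_le_mul_of_nonneg_right (by linarith : (natConst p)⁻¹ ≤ min (1 / p) (1 - 1 / p))
    (sq_nonneg (‖a‖ ^ (p / 2) - ‖b‖ ^ (p / 2)))).trans l1
  have L2 := (mul_le_mul_of_nonneg_right hc
    (sq_nonneg (‖a‖ ^ (p / 2) + ‖b‖ ^ (p / 2)))).trans l2
  have U1 := u1.trans (mul_le_mul_of_nonneg_right hM (sq_nonneg _))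
  have U2 := u2.trans (mul_le_mul_of_nonneg_right hc2 (sq_nonneg _))
  have t1 : 0 ≤ (1 + τ) / 2 := by linarith
  have t2 : 0 ≤ (1 - τ) / 2 := by linarith
  constructor
  · have := add_le_add (mul_le_mul_of_nonneg_left L1 t1) (mul_le_mul_of_nonneg_left L2 t2)
    linarith
  · have := add_le_add (mul_le_mul_of_nonneg_left U1 t1) (mul_le_mul_of_nonneg_left U2 t2)
    linarith

lemma bregman_nonneg {d : ℕ} {p : ℝ} (hp : 1 < p) (a b : Space d) : 0 ≤ bregman p a b :=
  (mul_nonneg (inv_nonneg.2 (natConst_pos hp).le) (sq_nonneg _)).trans (bregman_bounds hp a b).1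

lemma continuous_natF {d : ℕ} {p : ℝ} (hp : 1 < p) : Continuous (natF p : Space d → Space d) := by
  rw [continuous_iff_continuousAt]
  intro a
  rcases eq_or_ne a 0 with rfl | ha
  · have h0 : natF p (0 : Space d) = 0 := by simp [natF]
    rw [ContinuousAt, h0, tendsto_zero_iff_norm_tendsto_zero]
    simp_rw [norm_natF hp]
    have : Continuous fun a : Space d => ‖a‖ ^ (p / 2) :=
      continuous_norm.rpow_const fun _ => Or.inr (by linarith)
    have h := this.tendsto 0
    rwa [norm_zero, zero_rpow (by linarith)] at h
  · exact (continuousAt_id.norm.rpow_const (Or.inl (norm_ne_zero_iff.2 ha))).smul continuousAt_id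

lemma natF_injective {d : ℕ} {p : ℝ} (hp : 1 < p) :
    Function.Injective (natF p : Space d → Space d) := by
  intro a b h
  have hn : ‖a‖ = ‖b‖ := by
    have := congrArg norm h
    rw [norm_natF hp, norm_natF hp] at this
    exact (rpow_left_inj (norm_nonneg _) (norm_nonneg _) (by linarith)).1 this
  rcases eq_or_ne a 0 with rfl | ha
  · rw [norm_zero] at hn
    exact (norm_eq_zero.1 hn.symm).symm
  · unfold natF at h
    rw [← hn] at h
    exact smul_right_injective _ (rpow_pos_of_pos (norm_pos_iff.2 ha) _).ne' h

lemma natF_smul {d : ℕ} {p m : ℝ} (hm : 0 < m) (a : Space d) :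
    natF p (m • a) = m ^ (p / 2) • natF p a := by
  unfold natF
  rw [norm_smul, norm_of_nonneg hm.le, mul_rpow hm.le (norm_nonneg _), smul_smul, smul_smul,
    mul_right_comm, ← rpow_add_one hm.ne']
  congr 3
  ring

/-- The pairs in question form a compact set away from the diagonal, where the continuous right-hand
side is positive because `natF` is injective. -/
lemma exists_le_norm_natF_sub_sq {d : ℕ} {p ε : ℝ} (hp : 1 < p) (hε : 0 < ε) :
    ∃ k : ℝ, 0 < k ∧ ∀ a b : Space d, ‖a‖ ≤ 1 → ‖b‖ ≤ 1 → ε ≤ ‖a - b‖ ^ p →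
      k ≤ ‖natF p a - natF p b‖ ^ 2 := by
  have hp0 : 0 < p := by linarith
  have hcF := continuous_natF (d := d) hp
  have hS : IsCompact ((Metric.closedBall (0 : Space d) 1 ×ˢ Metric.closedBall (0 : Space d) 1) ∩
      {z : Space d × Space d | ε ≤ ‖z.1 - z.2‖ ^ p}) :=
    ((isCompact_closedBall _ _).prod (isCompact_closedBall _ _)).inter_right
      (isClosed_le continuous_const
        ((continuous_fst.sub continuous_snd).norm.rpow_const fun _ => Or.inr hp0.le))
  have hcont : Continuous fun z : Space d × Space d => ‖natF p z.1 - natF p z.2‖ ^ 2 :=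
    ((hcF.comp continuous_fst).sub (hcF.comp continuous_snd)).norm.pow 2
  obtain ⟨k, hk, hkS⟩ := hS.exists_forall_le' (a := (0 : ℝ)) hcont.continuousOn (by
      rintro ⟨a, b⟩ ⟨-, hz⟩
      refine pow_pos (norm_pos_iff.2 (sub_ne_zero.2 fun h => ?_)) 2
      have hz : ε ≤ ‖a - b‖ ^ p := hz
      have hab : a = b := natF_injective hp h
      rw [hab, sub_self, norm_zero, zero_rpow hp0.ne'] at hz
      linarith)
  exact ⟨k, hk, fun a b ha hb h => hkS (a, b)
    ⟨⟨mem_closedBall_zero_iff.2 ha, mem_closedBall_zero_iff.2 hb⟩, h⟩⟩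

/-- Uniform convexity of `|·|^p`, in terms of `F`. -/
lemma exists_norm_sub_rpow_le {d : ℕ} {p ε : ℝ} (hp : 1 < p) (hε : 0 < ε) :
    ∃ K : ℝ, 0 < K ∧ ∀ a b : Space d,
      ‖a - b‖ ^ p ≤ ε * (‖a‖ ^ p + ‖b‖ ^ p) + K * ‖natF p a - natF p b‖ ^ 2 := by
  have hp0 : 0 < p := by linarith
  obtain ⟨k, hk, hkS⟩ := exists_le_norm_natF_sub_sq (d := d) hp hε
  refine ⟨2 ^ p / k, by positivity, fun a b => ?_⟩
  set m := max ‖a‖ ‖b‖ with hm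
  have ham : ‖a‖ ≤ m := le_max_left _ _
  have hbm : ‖b‖ ≤ m := le_max_right _ _
  have hmp : m ^ p ≤ ‖a‖ ^ p + ‖b‖ ^ p := by
    rcases max_choice ‖a‖ ‖b‖ with h | h <;> rw [hm, h]
    · exact le_add_of_nonneg_right (by positivity)
    · exact le_add_of_nonneg_left (by positivity)
  rcases eq_or_lt_of_le ((norm_nonneg a).trans ham) with h0 | h0
  · have ha : a = 0 := norm_le_zero_iff.1 (ham.trans h0.ge)
    have hb : b = 0 := norm_le_zero_iff.1 (hbm.trans h0.ge)
    rw [ha, hb, sub_self, norm_zero, zero_rpow hp0.ne', sub_self, norm_zero]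
    simp
  -- Either the first term already suffices, or the pair divided by `m` lies in the compact set of
  -- `exists_le_norm_natF_sub_sq`; homogeneity of `natF` then scales the bound back.
  by_cases hc : ‖a - b‖ ^ p ≤ ε * m ^ p
  · calc ‖a - b‖ ^ p ≤ ε * m ^ p := hc
      _ ≤ ε * (‖a‖ ^ p + ‖b‖ ^ p) := by gcongr
      _ ≤ _ := le_add_of_nonneg_right (by positivity)
  push Not at hc
  have hs : ∀ c : Space d, c = m • (m⁻¹ • c) := fun c => by
    rw [smul_smul, mul_inv_cancel₀ h0.ne', one_smul]
  have hn : ∀ c : Space d, ‖c‖ ≤ m → ‖m⁻¹ • c‖ ≤ 1 := fun c h => by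
    rw [norm_smul, norm_of_nonneg (inv_nonneg.2 h0.le), inv_mul_le_iff₀ h0, mul_one]
    exact h
  have hk2 : k ≤ ‖natF p (m⁻¹ • a) - natF p (m⁻¹ • b)‖ ^ 2 := by
    refine hkS _ _ (hn a ham) (hn b hbm) ?_
    rw [← smul_sub, norm_smul, norm_of_nonneg (inv_nonneg.2 h0.le),
      mul_rpow (inv_nonneg.2 h0.le) (norm_nonneg _), inv_rpow h0.le, ← div_eq_inv_mul,
      le_div_iff₀ (by positivity)]
    exact hc.le
  have hF : ‖natF p a - natF p b‖ ^ 2 =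
      m ^ p * ‖natF p (m⁻¹ • a) - natF p (m⁻¹ • b)‖ ^ 2 := by
    rw [hs a, hs b, natF_smul h0, natF_smul h0, ← smul_sub, norm_smul,
      norm_of_nonneg (by positivity), mul_pow, ← rpow_natCast (m ^ (p / 2)), ← rpow_mul h0.le,
      ← hs, ← hs]
    congr 2
    push_cast
    ring
  have h2 : ‖a - b‖ ^ p ≤ 2 ^ p * m ^ p := by
    rw [← mul_rpow (by norm_num) h0.le]
    exact rpow_le_rpow (norm_nonneg _) ((norm_sub_le a b).trans (by linarith)) hp0.le
  calc ‖a - b‖ ^ p ≤ 2 ^ p * m ^ p := h2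
    _ = 2 ^ p / k * (m ^ p * k) := by field_simp
    _ ≤ 2 ^ p / k * ‖natF p a - natF p b‖ ^ 2 := by rw [hF]; gcongr
    _ ≤ _ := le_add_of_nonneg_left (by positivity)

/-- Uniform convexity of `|·|^p`, in terms of the Bregman distance. -/
lemma exists_norm_sub_rpow_le_bregman {d : ℕ} {p ε : ℝ} (hp : 1 < p) (hε : 0 < ε) :
    ∃ K : ℝ, 0 < K ∧ ∀ a b : Space d,
      ‖b - a‖ ^ p ≤ ε * (‖b‖ ^ p + ‖a‖ ^ p) + K * bregman p a b := by
  obtain ⟨K, hK, h⟩ := exists_norm_sub_rpow_le (d := d) hp hε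
  have hc := natConst_pos hp
  refine ⟨K * natConst p, by positivity, fun a b => (h b a).trans ?_⟩
  have := (inv_mul_le_iff₀ hc).1 (bregman_bounds hp a b).1
  rw [mul_assoc]
  gcongr

/-- Young's inequality with a small coefficient. -/
lemma exists_mul_le_rpow_add_rpow {p q ε : ℝ} (hpq : p.HolderConjugate q) (hε : 0 < ε) :
    ∃ C : ℝ, 0 < C ∧ ∀ a b : ℝ, 0 ≤ a → 0 ≤ b → a * b ≤ ε * a ^ p + C * b ^ q := by
  have hp := hpq.pos
  have hq := hpq.symm.pos
  have hp1 : 1 / p ≤ 1 := by rw [div_le_one hp]; exact hpq.lt.le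
  -- Young's inequality is applied to `s a` and `b / s`, with `s^p = ε`.
  let s : ℝ := ε ^ (1 / p)
  have hs : 0 < s := rpow_pos_of_pos hε _
  have hsp : s ^ p = ε := by
    rw [← rpow_mul hε.le, one_div_mul_cancel hp.ne', rpow_one]
  refine ⟨s⁻¹ ^ q / q, by positivity, fun a b ha hb => ?_⟩
  have h := young_inequality_of_nonneg (mul_nonneg hs.le ha) (mul_nonneg (inv_pos.2 hs).le hb) hpq
  rw [mul_rpow hs.le ha, mul_rpow (inv_pos.2 hs).le hb, hsp] at h
  have e : s * a * (s⁻¹ * b) = a * b := by field_simp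
  rw [e] at h
  have h2 : ε * a ^ p / p ≤ ε * a ^ p := div_le_self (by positivity) hpq.lt.le
  calc a * b ≤ _ := h
    _ ≤ ε * a ^ p + s⁻¹ ^ q * b ^ q / q := by gcongr
    _ = _ := by ring

end Pointwise

/-! ### Norms in `L^p` as integrals. -/

section LpNorm

variable {α : Type*} [MeasurableSpace α] {μ : Measure α} {E : Type*} [NormedAddCommGroup E]

lemma Lp_norm_rpow {p : ℝ} (hp : 0 < p) (f : Lp E (ENNReal.ofReal p) μ) :
    ‖f‖ ^ p = ∫ x, ‖f x‖ ^ p ∂μ := by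
  have h := lpNorm_eq_integral_norm_rpow_toReal (p := ENNReal.ofReal p) (by simpa using hp)
    (by simp) (Lp.memLp f).1
  rw [Lp.norm_def, toReal_eLpNorm (Lp.memLp f).1, h, ENNReal.toReal_ofReal hp.le,
    ← Real.rpow_mul (integral_nonneg fun x => by positivity), inv_mul_cancel₀ hp.ne',
    Real.rpow_one]

lemma integrable_norm_rpow_of_memLp {p : ℝ} (hp : 0 < p) {f : α → E}
    (hf : MemLp f (ENNReal.ofReal p) μ) : Integrable (fun x => ‖f x‖ ^ p) μ := by
  have := hf.integrable_norm_rpow (by simpa using hp) (by simp)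
  rwa [ENNReal.toReal_ofReal hp.le] at this

end LpNorm

/-! ### Completeness of the Sobolev spaces. -/

section Complete

variable {d : ℕ} {Ω : Opens (Space d)} {q : ℝ≥0∞}

lemma continuous_gradient_testFunction (φ : 𝓓(Ω, ℝ)) : Continuous (gradient φ) := by
  unfold gradient
  exact (LinearIsometryEquiv.continuous _).comp (φ.contDiff.continuous_fderiv (by simp))

lemma hasCompactSupport_gradient_testFunction (φ : 𝓓(Ω, ℝ)) :
    HasCompactSupport (gradient φ) :=
  (φ.hasCompactSupport.fderiv (𝕜 := ℝ)).comp_left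
    (g := (InnerProductSpace.toDual ℝ (Space d)).symm) (map_zero _)

variable [Fact (1 ≤ q)]

/-- By Hölder, pairing with `φ` or `∇φ`, both in the dual Lebesgue space, is continuous. Hence each
test function imposes a closed condition. -/
lemma isClosed_sobolev : IsClosed (sobolev Ω q : Set (FunGradPair Ω q)) := by
  have hS : (sobolev Ω q : Set (FunGradPair Ω q)) = ⋂ φ : 𝓓(Ω, ℝ), {w : FunGradPair Ω q |
      ∫ x in Ω, w.fst x • gradient φ x = - ∫ x in Ω, φ x • w.snd x} := by
    ext w
    simp only [Set.mem_iInter]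
    rfl
  rw [hS]
  refine isClosed_iInter fun φ => ?_
  have hr : Fact (1 ≤ ENNReal.conjExponent q) :=
    ⟨(ENNReal.HolderConjugate.conjExponent (Fact.out : 1 ≤ q)).symm.one_le⟩
  have h1 : MemLp (gradient φ) (ENNReal.conjExponent q) (volume.restrict (Ω : Set (Space d))) :=
    (continuous_gradient_testFunction φ).memLp_of_hasCompactSupport
      (hasCompactSupport_gradient_testFunction φ)
  have h2 : MemLp φ (ENNReal.conjExponent q) (volume.restrict (Ω : Set (Space d))) :=
    φ.continuous.memLp_of_hasCompactSupport φ.hasCompactSupport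
  let B : ℝ →L[ℝ] Space d →L[ℝ] Space d := ContinuousLinearMap.lsmul ℝ ℝ
  let T := B.lpPairing (volume.restrict (Ω : Set (Space d))) q (ENNReal.conjExponent q)
  let T' := B.flip.lpPairing (volume.restrict (Ω : Set (Space d))) q (ENNReal.conjExponent q)
  have e1 : ∀ w : FunGradPair Ω q, ∫ x in Ω, w.fst x • gradient φ x = T w.fst h1.toLp := by
    intro w
    rw [ContinuousLinearMap.lpPairing_eq_integral]
    refine integral_congr_ae ?_
    filter_upwards [h1.coeFn_toLp] with x hx
    rw [hx]
    rfl
  have e2 : ∀ w : FunGradPair Ω q, ∫ x in Ω, φ x • w.snd x = T' w.snd h2.toLp := by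
    intro w
    rw [ContinuousLinearMap.lpPairing_eq_integral]
    refine integral_congr_ae ?_
    filter_upwards [h2.coeFn_toLp] with x hx
    rw [hx]
    rfl
  simp_rw [e1, e2]
  have hf : Continuous (fun w : FunGradPair Ω q => w.fst) := WithLp.continuous_fst ..
  have hs : Continuous (fun w : FunGradPair Ω q => w.snd) := WithLp.continuous_snd ..
  exact isClosed_eq ((T.flip h1.toLp).continuous.comp hf) ((T'.flip h2.toLp).continuous.comp hs).neg

instance : CompleteSpace (SobolevZero Ω q) := by
  have h1 : CompleteSpace (sobolev Ω q) := isClosed_sobolev.completeSpace_coe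
  exact ((testFunctions Ω q).isClosed_topologicalClosure).completeSpace_coe

variable (Ω q) in
/-- The function of an element of `W_0^{1,q}(Ω)`, as an element of `L^q(Ω)`. -/
def funL : SobolevZero Ω q →L[ℝ] Lp ℝ q (volume.restrict (Ω : Set (Space d))) :=
  (WithLp.fstL 1 ℝ _ _).comp ((sobolev Ω q).subtypeL.comp (sobolevZero Ω q).subtypeL)

variable (Ω q) in
/-- The gradient of an element of `W_0^{1,q}(Ω)`, as an element of `L^q(Ω)^d`. -/
def gradL : SobolevZero Ω q →L[ℝ] Lp (Space d) q (volume.restrict (Ω : Set (Space d))) :=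
  (WithLp.sndL 1 ℝ _ _).comp ((sobolev Ω q).subtypeL.comp (sobolevZero Ω q).subtypeL)

lemma norm_eq_add (v : SobolevZero Ω q) : ‖v‖ = ‖funL Ω q v‖ + ‖gradL Ω q v‖ :=
  WithLp.prod_norm_eq_of_L1 v.1.1

end Complete

/-! ### The Poincaré inequality. -/

section Poincare

open Real

lemma norm_gradient {d : ℕ} (φ : Space d → ℝ) (x : Space d) :
    ‖gradient φ x‖ = ‖fderiv ℝ φ x‖ := LinearIsometryEquiv.norm_map _ _

/-- Integration by parts against a coordinate function. -/
lemma integral_abs_rpow_le {d : ℕ} (hd : 1 ≤ d) {p R : ℝ} (hp : 1 < p) {φ : Space d → ℝ}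
    (hφ : ContDiff ℝ 1 φ) (hc : HasCompactSupport φ) (hR : ∀ x ∈ tsupport φ, ‖x‖ ≤ R) :
    ∫ x, ‖φ x‖ ^ p ≤ ∫ x, ‖φ x‖ ^ (p - 1) * (p * R * ‖gradient φ x‖) := by
  -- The condition `1 ≤ d` provides a coordinate function `ℓ`. It has derivative 1 along `e`, so
  -- integrating `|φ|^p · 1` by parts moves the derivative onto `|φ|^p`.
  let i : Fin d := ⟨0, hd⟩
  let e : Space d := EuclideanSpace.single i 1
  let ℓ : Space d →L[ℝ] ℝ := innerSL ℝ e
  have he : ‖e‖ = 1 := by simp [e]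
  have hℓe : ℓ e = 1 := by
    show inner ℝ e e = 1
    rw [real_inner_self_eq_norm_sq, he, one_pow]
  have hℓ : ∀ x, ‖ℓ x‖ ≤ ‖x‖ := fun x => by
    have := ℓ.le_opNorm x
    rwa [innerSL_apply_norm, he, one_mul] at this
  let f : Space d → ℝ := fun x => ‖φ x‖ ^ p
  have hf : ContDiff ℝ 1 f := hφ.norm_rpow hp
  have hfc : HasCompactSupport f := hc.comp_left (g := fun t : ℝ => ‖t‖ ^ p) (by
    rw [norm_zero, zero_rpow (by linarith)])
  have hf' : Continuous (fderiv ℝ f) := hf.continuous_fderiv one_ne_zero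
  have hfc' : HasCompactSupport (fderiv ℝ f) := hfc.fderiv (𝕜 := ℝ)
  have hdφ : Continuous (fderiv ℝ φ) := hφ.continuous_fderiv one_ne_zero
  have hcont : Continuous fun x => fderiv ℝ f x e * ℓ x :=
    (hf'.clm_apply continuous_const).mul ℓ.continuous
  have hcs : HasCompactSupport fun x => fderiv ℝ f x e * ℓ x :=
    (hfc'.comp_left (g := fun L : Space d →L[ℝ] ℝ => L e) rfl).mul_right
  have hib : ∫ x, f x = - ∫ x, fderiv ℝ f x e * ℓ x := by
    have h := integral_mul_fderiv_eq_neg_fderiv_mul_of_integrable (μ := (volume : Measure (Space d)))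
      (f := f) (g := ℓ) (v := e) (hcont.integrable_of_hasCompactSupport hcs)
      (by
        simp only [ContinuousLinearMap.fderiv, hℓe, mul_one]
        exact hf.continuous.integrable_of_hasCompactSupport hfc)
      ((hf.continuous.mul ℓ.continuous).integrable_of_hasCompactSupport hfc.mul_right)
      (fun x _ => hf.differentiable one_ne_zero x) (fun x _ => ℓ.differentiableAt)
    simpa only [ContinuousLinearMap.fderiv, hℓe, mul_one] using h
  rw [show (∫ x, ‖φ x‖ ^ p) = ∫ x, f x from rfl, hib, ← integral_neg]
  refine integral_mono (hcont.integrable_of_hasCompactSupport hcs).neg ?_ fun x => ?_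
  · refine Continuous.integrable_of_hasCompactSupport ?_ ?_
    · simp_rw [norm_gradient]
      exact (hφ.continuous.norm.rpow_const fun _ => Or.inr (by linarith)).mul
        (continuous_const.mul hdφ.norm)
    · exact (hc.comp_left (g := fun t : ℝ => ‖t‖ ^ (p - 1)) (by
        rw [norm_zero, zero_rpow (by linarith)])).mul_right
  · by_cases hx : x ∈ tsupport φ
    · have h1 := norm_fderiv_norm_rpow_le (hφ.differentiable one_ne_zero) (x := x) hp
      have h2 : ‖fderiv ℝ f x e‖ ≤ p * ‖φ x‖ ^ (p - 1) * ‖fderiv ℝ φ x‖ := by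
        refine ((fderiv ℝ f x).le_opNorm e).trans ?_
        rw [he, mul_one]
        exact h1
      calc -(fderiv ℝ f x e * ℓ x) ≤ ‖fderiv ℝ f x e * ℓ x‖ := neg_le_abs _
        _ = ‖fderiv ℝ f x e‖ * ‖ℓ x‖ := norm_mul _ _
        _ ≤ (p * ‖φ x‖ ^ (p - 1) * ‖fderiv ℝ φ x‖) * R := by
            gcongr
            exact (hℓ x).trans (hR x hx)
        _ = _ := by rw [norm_gradient]; ring
    -- The bound `R` is available only on the support; elsewhere both integrands vanish.
    · have hz : φ x = 0 := image_eq_zero_of_notMem_tsupport hx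
      have hz' : fderiv ℝ f x = 0 := by
        have hxf : x ∉ tsupport f := fun h => hx (closure_mono (fun y hy => by
          rw [Function.mem_support] at hy ⊢
          refine fun hy0 => hy ?_
          show ‖φ y‖ ^ p = 0
          rw [hy0, norm_zero, zero_rpow (by linarith)]) h)
        exact Function.notMem_support.1 fun h => hxf (support_fderiv_subset ℝ h)
      simp [hz, hz', zero_rpow (by linarith : p - 1 ≠ 0)]

/-- Poincaré inequality for smooth functions with support in a ball of radius `R`. -/
lemma exists_poincare_test {d : ℕ} (hd : 1 ≤ d) {p : ℝ} (hp : 1 < p) (R : ℝ) :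
    ∃ C : ℝ, 0 ≤ C ∧ ∀ φ : Space d → ℝ, ContDiff ℝ 1 φ → HasCompactSupport φ →
      (∀ x ∈ tsupport φ, ‖x‖ ≤ R) → ∫ x, ‖φ x‖ ^ p ≤ C * ∫ x, ‖gradient φ x‖ ^ p := by
  have hpq := Real.HolderConjugate.conjExponent hp
  have hR' : 0 ≤ |R| := abs_nonneg R
  -- Since `(p - 1) p' = p`, Young's inequality with coefficient `1/2` on the factor `|φ|^(p-1)`
  -- lets half of `∫ |φ|^p` be absorbed on the left.
  obtain ⟨C, hC, hY⟩ := exists_mul_le_rpow_add_rpow hpq.symm (ε := 1 / 2) (by norm_num)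
  refine ⟨2 * (C * (p * |R|) ^ p), by positivity, fun φ hφ hc hR => ?_⟩
  have h := integral_abs_rpow_le hd hp hφ hc fun x hx => (hR x hx).trans (le_abs_self R)
  have hdφ : Continuous (fderiv ℝ φ) := hφ.continuous_fderiv one_ne_zero
  have i1 : Integrable fun x => ‖φ x‖ ^ p :=
    (hφ.continuous.norm.rpow_const fun _ => Or.inr (by linarith)).integrable_of_hasCompactSupport
      (hc.comp_left (g := fun t : ℝ => ‖t‖ ^ p) (by rw [norm_zero, zero_rpow (by linarith)]))
  have i2 : Integrable fun x => ‖gradient φ x‖ ^ p := by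
    simp_rw [norm_gradient]
    exact (hdφ.norm.rpow_const fun _ => Or.inr (by linarith)).integrable_of_hasCompactSupport
      ((hc.fderiv (𝕜 := ℝ)).comp_left (g := fun t : Space d →L[ℝ] ℝ => ‖t‖ ^ p)
        (by rw [norm_zero, zero_rpow (by linarith)]))
  have h2 : ∫ x, ‖φ x‖ ^ (p - 1) * (p * |R| * ‖gradient φ x‖) ≤
      ∫ x, (1 / 2 * ‖φ x‖ ^ p + C * (p * |R|) ^ p * ‖gradient φ x‖ ^ p) := by
    refine integral_mono_of_nonneg (.of_forall fun x => by positivity)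
      ((i1.const_mul _).add (i2.const_mul _)) (.of_forall fun x => ?_)
    have := hY (‖φ x‖ ^ (p - 1)) (p * |R| * ‖gradient φ x‖) (by positivity) (by positivity)
    rw [← rpow_mul (norm_nonneg _), Real.mul_rpow (by positivity) (norm_nonneg _)] at this
    have e : (p - 1) * p.conjExponent = p := by
      have : p - 1 ≠ 0 := by linarith
      rw [Real.conjExponent]
      field_simp
    rw [e] at this
    calc _ ≤ _ := this
      _ = _ := by ring
  rw [integral_add (i1.const_mul _) (i2.const_mul _), integral_const_mul, integral_const_mul] at h2
  linarith

variable {d : ℕ} {Ω : Opens (Space d)} {p : ℝ} [hp : Fact (1 < p)]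

/-- **Poincaré inequality** on `W_0^{1,p}(Ω)`. -/
lemma exists_norm_funL_le (hd : 1 ≤ d) (hΩ : Bornology.IsBounded (Ω : Set (Space d))) :
    ∃ C : ℝ, 0 ≤ C ∧ ∀ v : SobolevZero Ω (ENNReal.ofReal p),
      ‖funL Ω _ v‖ ≤ C * ‖gradL Ω _ v‖ := by
  obtain ⟨R, hR⟩ := hΩ.exists_norm_le
  have hp1 : 1 < p := hp.out
  have hp0 : 0 < p := by linarith
  obtain ⟨C, hC, h⟩ := exists_poincare_test hd hp1 R
  refine ⟨C ^ (1 / p), by positivity, fun v => ?_⟩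
  -- The inequality is a closed condition, so it passes from test functions to their closure.
  have hcl : IsClosed {w : sobolev Ω (ENNReal.ofReal p) |
      ‖w.1.fst‖ ≤ C ^ (1 / p) * ‖w.1.snd‖} := by
    have hf : Continuous (fun w : sobolev Ω (ENNReal.ofReal p) => w.1.fst) :=
      (WithLp.continuous_fst ..).comp continuous_subtype_val
    have hs : Continuous (fun w : sobolev Ω (ENNReal.ofReal p) => w.1.snd) :=
      (WithLp.continuous_snd ..).comp continuous_subtype_val
    exact isClosed_le hf.norm (continuous_const.mul hs.norm)
  have hsub : ((testFunctions Ω (ENNReal.ofReal p) : Submodule ℝ _) : Set _) ⊆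
      {w : sobolev Ω (ENNReal.ofReal p) | ‖w.1.fst‖ ≤ C ^ (1 / p) * ‖w.1.snd‖} := by
    rintro w ⟨φ, h1, h2⟩
    have hφ := h φ (φ.contDiff.of_le (by simp)) φ.hasCompactSupport
      fun x hx => hR x (φ.tsupport_subset hx)
    have e1 : ‖w.1.fst‖ ^ p = ∫ x, ‖φ x‖ ^ p := by
      rw [Lp_norm_rpow hp0, ← setIntegral_eq_integral_of_forall_compl_eq_zero
        (s := (Ω : Set (Space d)))
        (f := fun x => ‖φ x‖ ^ p)]
      · exact integral_congr_ae (h1.mono fun x hx => by simp only [hx])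
      · intro x hx
        rw [image_eq_zero_of_notMem_tsupport fun h => hx (φ.tsupport_subset h), norm_zero,
          zero_rpow hp0.ne']
    have e2 : ‖w.1.snd‖ ^ p = ∫ x, ‖gradient φ x‖ ^ p := by
      rw [Lp_norm_rpow hp0, ← setIntegral_eq_integral_of_forall_compl_eq_zero
        (s := (Ω : Set (Space d)))
        (f := fun x => ‖gradient φ x‖ ^ p)]
      · exact integral_congr_ae (h2.mono fun x hx => by simp only [hx])
      · intro x hx
        have : fderiv ℝ φ x = 0 := by
          exact Function.notMem_support.1 fun h =>
            hx (φ.tsupport_subset (support_fderiv_subset ℝ h))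
        rw [norm_gradient, this, norm_zero, zero_rpow hp0.ne']
    rw [← e1, ← e2] at hφ
    show ‖w.1.fst‖ ≤ C ^ (1 / p) * ‖w.1.snd‖
    refine (rpow_le_rpow_iff (norm_nonneg _) (by positivity) hp0).1 ?_
    rwa [Real.mul_rpow (by positivity) (norm_nonneg _), ← rpow_mul hC,
      one_div_mul_cancel hp0.ne', rpow_one]
  exact closure_minimal hsub hcl v.2

end Poincare

/-! ### Convexity and differentiability of the Bregman distance. -/

section Bregman

open Real Filter Topology

/-- The Bregman distance is convex in its second argument and zero at `a`. After division by `t`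
this gives the dominating function in `tendsto_bregmanInt_div`. -/
lemma bregman_add_smul_le {d : ℕ} {p t : ℝ} (hp : 1 < p) (h0 : 0 ≤ t) (h1 : t ≤ 1)
    (a b : Space d) : bregman p a (a + t • b) ≤ t * bregman p a (a + b) := by
  have hn : ‖a + t • b‖ ≤ (1 - t) * ‖a‖ + t * ‖a + b‖ := by
    have e : a + t • b = (1 - t) • a + t • (a + b) := by
      rw [sub_smul, one_smul, smul_add]
      abel
    rw [e]
    refine (norm_add_le _ _).trans_eq ?_
    rw [norm_smul, norm_smul, norm_of_nonneg h0, norm_of_nonneg (sub_nonneg.2 h1)]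
  have hc := (convexOn_rpow hp.le).2 (x := ‖a‖) (norm_nonneg _) (y := ‖a + b‖) (norm_nonneg _)
    (sub_nonneg.2 h1) h0 (sub_add_cancel 1 t)
  simp only [smul_eq_mul] at hc
  have h2 := (rpow_le_rpow (norm_nonneg _) hn (by linarith : 0 ≤ p)).trans hc
  have h3 := mul_le_mul_of_nonneg_left h2 (by positivity : 0 ≤ 1 / p)
  rw [bregman, bregman, add_sub_cancel_left, add_sub_cancel_left, real_inner_smul_right]
  linarith

lemma tendsto_bregman_div {d : ℕ} {p : ℝ} (hp : 1 < p) (a b : Space d) {t : ℕ → ℝ}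
    (ht : ∀ n, 0 < t n) (ht0 : Tendsto t atTop (𝓝 0)) :
    Tendsto (fun n => (t n)⁻¹ * bregman p a (a + t n • b)) atTop (𝓝 0) := by
  have hline : HasDerivAt (fun s : ℝ => a + s • b) b 0 := by
    simpa using ((hasDerivAt_id (0 : ℝ)).smul_const b).const_add a
  have hF : HasFDerivAt (fun x : Space d => ‖x‖ ^ p) ((p * ‖a‖ ^ (p - 2)) • innerSL ℝ a)
      (a + (0 : ℝ) • b) := by
    rw [zero_smul, add_zero]
    exact hasFDerivAt_norm_rpow a hp
  have hD := (hF.comp_hasDerivAt (0 : ℝ) hline).tendsto_slope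
  have hD' := hD.comp (tendsto_nhdsWithin_iff.2 ⟨ht0, .of_forall fun n => (ht n).ne'⟩)
  have hlim := (hD'.const_mul (1 / p)).sub_const (‖a‖ ^ (p - 2) * inner ℝ a b)
  have hp0 : p ≠ 0 := by linarith
  have e0 : 1 / p * ((p * ‖a‖ ^ (p - 2)) • innerSL ℝ a) b - ‖a‖ ^ (p - 2) * inner ℝ a b = 0 := by
    show 1 / p * ((p * ‖a‖ ^ (p - 2)) * inner ℝ a b) - ‖a‖ ^ (p - 2) * inner ℝ a b = 0
    field_simp
    ring
  rw [e0] at hlim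
  refine hlim.congr fun n => ?_
  have hn := (ht n).ne'
  simp only [Function.comp, slope_def_field, zero_smul, add_zero, sub_zero]
  rw [bregman, add_sub_cancel_left, real_inner_smul_right]
  field_simp

/-- The linear terms cancel because the endpoints lie symmetrically about the midpoint. -/
lemma bregman_add_bregman_midpoint {d : ℕ} (p : ℝ) (a b : Space d) :
    bregman p ((1 / 2 : ℝ) • (a + b)) a + bregman p ((1 / 2 : ℝ) • (a + b)) b =
      (1 / p) * ‖a‖ ^ p + (1 / p) * ‖b‖ ^ p - 2 * ((1 / p) * ‖(1 / 2 : ℝ) • (a + b)‖ ^ p) := by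
  have e1 : a - (1 / 2 : ℝ) • (a + b) = (1 / 2 : ℝ) • (a - b) := by module
  have e2 : b - (1 / 2 : ℝ) • (a + b) = -((1 / 2 : ℝ) • (a - b)) := by module
  rw [bregman, bregman, e1, e2, inner_neg_right]
  ring

end Bregman

/-! ### The integrated Bregman distance on `L^p`. -/

section Integrated

open Real Filter Topology

variable {α : Type*} [MeasurableSpace α] {μ : Measure α} {d : ℕ} {p : ℝ} [hp : Fact (1 < p)]

lemma integrable_natF_sub_sq (h k : Lp (Space d) (ENNReal.ofReal p) μ) :
    Integrable (fun x => ‖natF p (k x) - natF p (h x)‖ ^ 2) μ := by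
  have hp1 : 1 < p := hp.out
  have hF := continuous_natF (d := d) hp1
  have ik := integrable_norm_rpow_of_memLp (by linarith) (Lp.memLp k)
  have ih := integrable_norm_rpow_of_memLp (by linarith) (Lp.memLp h)
  refine ((ik.add ih).const_mul 2).mono' ?_ (.of_forall fun x => ?_)
  · exact ((hF.comp_aestronglyMeasurable (Lp.memLp k).1).sub
      (hF.comp_aestronglyMeasurable (Lp.memLp h).1)).norm.pow 2
  · have h1 := norm_sub_le (natF p (k x)) (natF p (h x))
    have h2 := norm_nonneg (natF p (k x) - natF p (h x))
    rw [norm_of_nonneg (by positivity), Pi.add_apply, ← norm_natF_sq hp1, ← norm_natF_sq hp1]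
    nlinarith [sq_nonneg (‖natF p (k x)‖ - ‖natF p (h x)‖)]

lemma integrable_bregman (h k : Lp (Space d) (ENNReal.ofReal p) μ) :
    Integrable (fun x => bregman p (h x) (k x)) μ := by
  have hp1 : 1 < p := hp.out
  refine ((integrable_natF_sub_sq h k).const_mul (natConst p)).mono' ?_ (.of_forall fun x => ?_)
  · have mh := (Lp.memLp h).1
    have mk := (Lp.memLp k).1
    have m1 := mh.norm.aemeasurable
    have m2 := mk.norm.aemeasurable
    exact ((((m2.pow_const p).const_mul (1 / p)).sub ((m1.pow_const p).const_mul (1 / p))).sub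
      ((m1.pow_const (p - 2)).mul (mh.inner (𝕜 := ℝ) (mk.sub mh)).aemeasurable)).aestronglyMeasurable
  · rw [norm_of_nonneg (bregman_nonneg hp1 _ _)]
    exact (bregman_bounds hp1 _ _).2

/-- The integrated Bregman distance. -/
def bregmanInt (h k : Lp (Space d) (ENNReal.ofReal p) μ) : ℝ :=
  ∫ x, bregman p (h x) (k x) ∂μ

lemma bregmanInt_nonneg (h k : Lp (Space d) (ENNReal.ofReal p) μ) : 0 ≤ bregmanInt h k :=
  integral_nonneg fun _ => bregman_nonneg hp.out _ _

lemma bregmanInt_bounds (h k : Lp (Space d) (ENNReal.ofReal p) μ) :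
    (natConst p)⁻¹ * ∫ x, ‖natF p (k x) - natF p (h x)‖ ^ 2 ∂μ ≤ bregmanInt h k ∧
      bregmanInt h k ≤ natConst p * ∫ x, ‖natF p (k x) - natF p (h x)‖ ^ 2 ∂μ := by
  rw [← integral_const_mul, ← integral_const_mul]
  exact ⟨integral_mono ((integrable_natF_sub_sq h k).const_mul _) (integrable_bregman h k)
      fun x => (bregman_bounds hp.out _ _).1,
    integral_mono (integrable_bregman h k) ((integrable_natF_sub_sq h k).const_mul _)
      fun x => (bregman_bounds hp.out _ _).2⟩

/-- Hölder's inequality is avoided: the flux term is what remains of three integrable functions when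
the definition of `bregman` is solved for it. -/
lemma integrable_flux (h g : Lp (Space d) (ENNReal.ofReal p) μ) :
    Integrable (fun x => ‖h x‖ ^ (p - 2) * inner ℝ (h x) (g x)) μ := by
  have hp1 : 1 < p := hp.out
  have i1 := (integrable_norm_rpow_of_memLp (by linarith) (Lp.memLp (h + g))).const_mul (1 / p)
  have i2 := (integrable_norm_rpow_of_memLp (by linarith) (Lp.memLp h)).const_mul (1 / p)
  refine ((i1.sub i2).sub (integrable_bregman h (h + g))).congr ?_
  filter_upwards [Lp.coeFn_add h g] with x hx
  simp only [Pi.sub_apply, hx, Pi.add_apply, bregman, add_sub_cancel_left]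
  ring

lemma norm_rpow_add_smul (h g : Lp (Space d) (ENNReal.ofReal p) μ) (t : ℝ) :
    (1 / p) * ‖h + t • g‖ ^ p - (1 / p) * ‖h‖ ^ p =
      bregmanInt h (h + t • g) + t * ∫ x, ‖h x‖ ^ (p - 2) * inner ℝ (h x) (g x) ∂μ := by
  have hp1 : 1 < p := hp.out
  have hp0 : 0 < p := by linarith
  have i1 := (integrable_norm_rpow_of_memLp hp0 (Lp.memLp (h + t • g))).const_mul (1 / p)
  have i2 := (integrable_norm_rpow_of_memLp hp0 (Lp.memLp h)).const_mul (1 / p)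
  rw [Lp_norm_rpow hp0, Lp_norm_rpow hp0, bregmanInt, ← integral_const_mul, ← integral_const_mul,
    ← integral_const_mul, ← integral_sub i1 i2,
    ← integral_add (integrable_bregman h _) ((integrable_flux h g).const_mul t)]
  refine integral_congr_ae ?_
  filter_upwards [Lp.coeFn_add h (t • g), Lp.coeFn_smul t g] with x hx hx'
  simp only [hx, Pi.add_apply, hx', Pi.smul_apply, bregman, add_sub_cancel_left,
    real_inner_smul_right]
  ring

lemma tendsto_bregmanInt_div (h g : Lp (Space d) (ENNReal.ofReal p) μ) {t : ℕ → ℝ}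
    (ht : ∀ n, 0 < t n) (ht1 : ∀ n, t n ≤ 1) (ht0 : Tendsto t atTop (𝓝 0)) :
    Tendsto (fun n => (t n)⁻¹ * bregmanInt h (h + t n • g)) atTop (𝓝 0) := by
  have hp1 : 1 < p := hp.out
  have hae : ∀ᵐ x ∂μ, ∀ n, (h + t n • g : Lp (Space d) (ENNReal.ofReal p) μ) x =
      h x + t n • g x := by
    refine ae_all_iff.2 fun n => ?_
    filter_upwards [Lp.coeFn_add h (t n • g), Lp.coeFn_smul (t n) g] with x hx hx'
    rw [hx, Pi.add_apply, hx', Pi.smul_apply]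
  simp_rw [bregmanInt, ← integral_const_mul]
  have hlim := tendsto_integral_of_dominated_convergence (μ := μ)
    (F := fun n x => (t n)⁻¹ *
      bregman p (h x) ((h + t n • g : Lp (Space d) (ENNReal.ofReal p) μ) x))
    (f := fun _ => 0)
    (fun x => bregman p (h x) ((h + g : Lp (Space d) (ENNReal.ofReal p) μ) x))
    (fun n => ((integrable_bregman h _).const_mul _).1) (integrable_bregman h _)
    (fun n => by
      filter_upwards [hae, Lp.coeFn_add h g] with x hx hx'
      rw [norm_of_nonneg (mul_nonneg (inv_nonneg.2 (ht n).le) (bregman_nonneg hp1 _ _)), hx, hx',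
        Pi.add_apply, inv_mul_le_iff₀ (ht n)]
      exact bregman_add_smul_le hp1 (ht n).le (ht1 n) _ _)
    (by
      filter_upwards [hae] with x hx
      simp_rw [hx]
      exact tendsto_bregman_div hp1 _ _ ht ht0)
  rwa [integral_zero] at hlim

/-- Uniform convexity of `L^p` in terms of the Bregman distance. -/
lemma exists_norm_sub_lt_of_bregmanInt (B : ℝ) {δ : ℝ} (hδ : 0 < δ) :
    ∃ η : ℝ, 0 < η ∧ ∀ h k : Lp (Space d) (ENNReal.ofReal p) μ, ‖h‖ ^ p ≤ B → ‖k‖ ^ p ≤ B →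
      bregmanInt h k ≤ η → ‖k - h‖ < δ := by
  have hp1 : 1 < p := hp.out
  have hp0 : 0 < p := by linarith
  have hδp : 0 < δ ^ p := rpow_pos_of_pos hδ p
  -- With these choices the two terms contribute at most `δ^p / 2` and `δ^p / 4`, which leaves a
  -- strict inequality. The absolute value covers negative `B`.
  obtain ⟨K, hK, hKb⟩ := exists_norm_sub_rpow_le_bregman (d := d) (ε := δ ^ p / (4 * (|B| + 1)))
    hp1 (by positivity)
  refine ⟨δ ^ p / (4 * K), by positivity, fun h k hh hk hb => ?_⟩
  refine (rpow_lt_rpow_iff (norm_nonneg _) hδ.le hp0).1 ?_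
  have ik := integrable_norm_rpow_of_memLp hp0 (Lp.memLp k)
  have ih := integrable_norm_rpow_of_memLp hp0 (Lp.memLp h)
  have is : Integrable (fun x => ‖k x‖ ^ p + ‖h x‖ ^ p) μ := ik.add ih
  have hle : ‖k - h‖ ^ p ≤ δ ^ p / (4 * (|B| + 1)) * (‖k‖ ^ p + ‖h‖ ^ p) + K * bregmanInt h k := by
    rw [Lp_norm_rpow hp0, Lp_norm_rpow hp0, Lp_norm_rpow hp0, bregmanInt, ← integral_add ik ih,
      ← integral_const_mul, ← integral_const_mul,
      ← integral_add (is.const_mul _) ((integrable_bregman h k).const_mul _)]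
    refine integral_mono_ae (integrable_norm_rpow_of_memLp hp0 (Lp.memLp _))
      ((is.const_mul _).add ((integrable_bregman h k).const_mul _)) ?_
    filter_upwards [Lp.coeFn_sub k h] with x hx
    rw [hx, Pi.sub_apply]
    exact hKb _ _
  have h1 : δ ^ p / (4 * (|B| + 1)) * (‖k‖ ^ p + ‖h‖ ^ p) ≤ δ ^ p / 2 := by
    have : ‖k‖ ^ p + ‖h‖ ^ p ≤ 2 * (|B| + 1) := by linarith [le_abs_self B]
    calc _ ≤ δ ^ p / (4 * (|B| + 1)) * (2 * (|B| + 1)) := by gcongr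
      _ = δ ^ p / 2 := by field_simp; norm_num
  have h2 : K * bregmanInt h k ≤ δ ^ p / 4 := by
    calc _ ≤ K * (δ ^ p / (4 * K)) := by gcongr
      _ = δ ^ p / 4 := by field_simp
  linarith

lemma eq_of_bregmanInt_le_zero {h k : Lp (Space d) (ENNReal.ofReal p) μ}
    (hb : bregmanInt h k ≤ 0) : k = h := by
  rw [← sub_eq_zero, ← norm_le_zero_iff]
  refine le_of_forall_gt_imp_ge_of_dense fun δ hδ => ?_
  obtain ⟨η, hη, H⟩ := exists_norm_sub_lt_of_bregmanInt (μ := μ) (d := d) (p := p)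
    (max (‖h‖ ^ p) (‖k‖ ^ p)) hδ
  exact (H h k (le_max_left _ _) (le_max_right _ _) (hb.trans hη.le)).le

lemma bregmanInt_add_bregmanInt_midpoint (h k : Lp (Space d) (ENNReal.ofReal p) μ) :
    bregmanInt ((1 / 2 : ℝ) • (h + k)) h + bregmanInt ((1 / 2 : ℝ) • (h + k)) k =
      (1 / p) * ‖h‖ ^ p + (1 / p) * ‖k‖ ^ p - 2 * ((1 / p) * ‖(1 / 2 : ℝ) • (h + k)‖ ^ p) := by
  have hp1 : 1 < p := hp.out
  have hp0 : 0 < p := by linarith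
  have i1 := (integrable_norm_rpow_of_memLp hp0 (Lp.memLp h)).const_mul (1 / p)
  have i2 := (integrable_norm_rpow_of_memLp hp0 (Lp.memLp k)).const_mul (1 / p)
  have i12 : Integrable (fun x => (1 / p) * ‖h x‖ ^ p + (1 / p) * ‖k x‖ ^ p) μ := i1.add i2
  have i3 := ((integrable_norm_rpow_of_memLp hp0
    (Lp.memLp ((1 / 2 : ℝ) • (h + k)))).const_mul (1 / p)).const_mul 2
  rw [bregmanInt, bregmanInt, ← integral_add (integrable_bregman _ _) (integrable_bregman _ _),
    Lp_norm_rpow hp0, Lp_norm_rpow hp0, Lp_norm_rpow hp0, ← integral_const_mul,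
    ← integral_const_mul, ← integral_const_mul, ← integral_const_mul, ← integral_add i1 i2,
    ← integral_sub i12 i3]
  refine integral_congr_ae ?_
  filter_upwards [Lp.coeFn_smul (1 / 2 : ℝ) (h + k), Lp.coeFn_add h k] with x hx hx'
  rw [hx, Pi.smul_apply, hx', Pi.add_apply]
  exact bregman_add_bregman_midpoint p _ _

end Integrated

/-! ### Abstract minimization: `A` plays the gradient and `ℓ` the load. -/

section Minimization

open Real Filter Topology

variable {α : Type*} [MeasurableSpace α] {μ : Measure α} {d : ℕ} {p : ℝ} [hp : Fact (1 < p)]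
  {X : Type*} [NormedAddCommGroup X] [NormedSpace ℝ X]
  (A : X →L[ℝ] Lp (Space d) (ENNReal.ofReal p) μ)

/-- The energy `(1/p) ‖A v‖^p - ℓ v`. -/
def dualEnergy (ℓ : X →L[ℝ] ℝ) (v : X) : ℝ := (1 / p) * ‖A v‖ ^ p - ℓ v

/-- The energy gap at a minimizer is the Bregman distance of the gradients. -/
lemma dualEnergy_sub_eq {ℓ : X →L[ℝ] ℝ} {u : X} (hu : ∀ v, dualEnergy A ℓ u ≤ dualEnergy A ℓ v)
    (v : X) : dualEnergy A ℓ v - dualEnergy A ℓ u = bregmanInt (A u) (A v) := by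
  have key : ∀ (w : X) (t : ℝ), dualEnergy A ℓ (u + t • w) - dualEnergy A ℓ u =
      bregmanInt (A u) (A u + t • A w) +
        t * ((∫ x, ‖A u x‖ ^ (p - 2) * inner ℝ (A u x) (A w x) ∂μ) - ℓ w) := by
    intro w t
    have := norm_rpow_add_smul (A u) (A w) t
    rw [dualEnergy, dualEnergy, map_add, map_smul, map_add, map_smul, smul_eq_mul]
    linarith
  -- Divide the nonnegative energy increment by `t` and let `t → 0`: the Bregman part is `o(t)`,
  -- leaving a nonnegative first variation.
  have hnn : ∀ w : X, 0 ≤ (∫ x, ‖A u x‖ ^ (p - 2) * inner ℝ (A u x) (A w x) ∂μ) - ℓ w := by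
    intro w
    have ht : ∀ n : ℕ, (0 : ℝ) < 1 / ((n : ℝ) + 1) := fun n => Nat.one_div_pos_of_nat
    have hlim := tendsto_bregmanInt_div (A u) (A w) ht (fun n => by
      rw [div_le_one (by positivity)]
      linarith [(Nat.cast_nonneg n : (0 : ℝ) ≤ n)]) tendsto_one_div_add_atTop_nhds_zero_nat
    have hlim' := hlim.add_const ((∫ x, ‖A u x‖ ^ (p - 2) * inner ℝ (A u x) (A w x) ∂μ) - ℓ w)
    rw [zero_add] at hlim'
    refine ge_of_tendsto' hlim' fun n => ?_
    have h1 := key w (1 / ((n : ℝ) + 1))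
    have h2 : 0 ≤ dualEnergy A ℓ (u + (1 / ((n : ℝ) + 1)) • w) - dualEnergy A ℓ u :=
      sub_nonneg.2 (hu _)
    rw [h1] at h2
    have h3 := mul_nonneg (inv_nonneg.2 (ht n).le) h2
    rwa [mul_add, inv_mul_cancel_left₀ (ht n).ne'] at h3
  -- Directions `v - u` and `-(v - u)` together give the Euler-Lagrange equation; `key` with `t = 1`
  -- then has no linear term.
  have hz : (∫ x, ‖A u x‖ ^ (p - 2) * inner ℝ (A u x) (A (v - u) x) ∂μ) - ℓ (v - u) = 0 := by
    refine le_antisymm ?_ (hnn _)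
    have h := hnn (-(v - u))
    have e : ∫ x, ‖A u x‖ ^ (p - 2) * inner ℝ (A u x) (A (-(v - u)) x) ∂μ =
        - ∫ x, ‖A u x‖ ^ (p - 2) * inner ℝ (A u x) (A (v - u) x) ∂μ := by
      rw [← integral_neg]
      refine integral_congr_ae ?_
      rw [map_neg]
      filter_upwards [Lp.coeFn_neg (A (v - u))] with x hx
      rw [hx, Pi.neg_apply, inner_neg_right, mul_neg]
    rw [e, map_neg] at h
    linarith
  have h := key (v - u) 1
  rwa [hz, mul_zero, add_zero, one_smul, one_smul, ← map_add, add_sub_cancel] at h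

/-- Coercivity of the energy. -/
lemma exists_norm_rpow_le_dualEnergy {q : ℝ} (hpq : p.HolderConjugate q) {C : ℝ} (hC : 0 ≤ C)
    (hA : ∀ v, ‖v‖ ≤ C * ‖A v‖) :
    ∃ K : ℝ, 0 ≤ K ∧ ∀ (ℓ : X →L[ℝ] ℝ) (v : X),
      ‖A v‖ ^ p ≤ 2 * p * dualEnergy A ℓ v + K * ‖ℓ‖ ^ q := by
  have hp0 : 0 < p := hpq.pos
  -- After multiplication by `2p` the energy contains `2‖A v‖^p`, and this `ε` consumes exactly one
  -- of the two copies.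
  obtain ⟨K, hK, hY⟩ := exists_mul_le_rpow_add_rpow hpq (ε := 1 / (2 * p)) (by positivity)
  refine ⟨2 * p * (K * C ^ q), by positivity, fun ℓ v => ?_⟩
  have h1 := hY ‖A v‖ (C * ‖ℓ‖) (norm_nonneg _) (by positivity)
  have h2 : ℓ v ≤ ‖A v‖ * (C * ‖ℓ‖) := by
    calc ℓ v ≤ ‖ℓ v‖ := le_norm_self _
      _ ≤ ‖ℓ‖ * ‖v‖ := ℓ.le_opNorm v
      _ ≤ ‖ℓ‖ * (C * ‖A v‖) := by gcongr; exact hA v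
      _ = _ := by ring
  rw [Real.mul_rpow hC (norm_nonneg _)] at h1
  have h3 := h2.trans h1
  have e : 2 * p * dualEnergy A ℓ v = 2 * ‖A v‖ ^ p - 2 * p * ℓ v := by
    rw [dualEnergy]
    field_simp
  have h4 := mul_le_mul_of_nonneg_left h3 (by positivity : 0 ≤ 2 * p)
  have e2 : 2 * p * (1 / (2 * p) * ‖A v‖ ^ p + K * (C ^ q * ‖ℓ‖ ^ q)) =
      ‖A v‖ ^ p + 2 * p * (K * C ^ q) * ‖ℓ‖ ^ q := by
    field_simp
  rw [e2] at h4
  rw [e]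
  linarith

/-- Uniform convexity replaces weak compactness: a minimizing sequence is Cauchy, because
near-minimal energies of two points and of their midpoint bound the Bregman distances between them.
-/
lemma exists_isUniqueMinimizer_dualEnergy [CompleteSpace X] {C : ℝ} (hC : 0 ≤ C)
    (hA : ∀ v, ‖v‖ ≤ C * ‖A v‖) (ℓ : X →L[ℝ] ℝ) :
    ∃ u, IsUniqueMinimizer (dualEnergy A ℓ) u := by
  have hp1 : 1 < p := hp.out
  have hp0 : 0 < p := by linarith
  obtain ⟨K, hK, hco⟩ := exists_norm_rpow_le_dualEnergy A (Real.HolderConjugate.conjExponent hp1)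
    hC hA
  set Q := K * ‖ℓ‖ ^ p.conjExponent with hQ
  have hbdd : BddBelow (Set.range (dualEnergy A ℓ)) := by
    refine ⟨-(Q / (2 * p)), ?_⟩
    rintro _ ⟨v, rfl⟩
    have h := hco ℓ v
    have h0 : 0 ≤ ‖A v‖ ^ p := by positivity
    rw [neg_le_iff_add_nonneg, ← hQ] at *
    have : 0 ≤ (2 * p) * (dualEnergy A ℓ v + Q / (2 * p)) := by
      rw [mul_add, mul_div_cancel₀ _ (by positivity)]
      linarith
    exact nonneg_of_mul_nonneg_right this (by positivity)
  set I := ⨅ v, dualEnergy A ℓ v with hI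
  have hle : ∀ v, I ≤ dualEnergy A ℓ v := fun v => ciInf_le hbdd v
  have hex : ∀ n : ℕ, ∃ v, dualEnergy A ℓ v < I + 1 / ((n : ℝ) + 1) := fun n =>
    exists_lt_of_ciInf_lt (lt_add_of_pos_right _ Nat.one_div_pos_of_nat)
  choose v hv using hex
  have hcau : CauchySeq v := by
    rw [Metric.cauchySeq_iff]
    intro ε hε
    set B := 2 * p * (I + 1) + Q with hB
    have hvB : ∀ n, ‖A (v n)‖ ^ p ≤ B := fun n => by
      have h1 : (1 : ℝ) / ((n : ℝ) + 1) ≤ 1 := by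
        rw [div_le_one (by positivity)]
        linarith [(Nat.cast_nonneg n : (0 : ℝ) ≤ n)]
      have h2 := hco ℓ (v n)
      have h3 : 2 * p * dualEnergy A ℓ (v n) ≤ 2 * p * (I + 1) :=
        mul_le_mul_of_nonneg_left ((hv n).le.trans (by linarith)) (by positivity)
      linarith
    obtain ⟨η, hη, hH⟩ := exists_norm_sub_lt_of_bregmanInt (μ := μ) (d := d) (p := p) B
      (δ := ε / (2 * (C + 1))) (by positivity)
    obtain ⟨n₀, hn₀⟩ := exists_nat_one_div_lt (half_pos hη)
    refine ⟨n₀, fun m hm n hn => ?_⟩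
    have hsmall : ∀ k ≥ n₀, dualEnergy A ℓ (v k) ≤ I + η / 2 := fun k hk => by
      have : (1 : ℝ) / ((k : ℝ) + 1) ≤ 1 / ((n₀ : ℝ) + 1) := Nat.one_div_le_one_div hk
      linarith [hv k]
    have hmid := bregmanInt_add_bregmanInt_midpoint (A (v m)) (A (v n))
    have hE := hle ((1 / 2 : ℝ) • (v m + v n))
    have hb1 := bregmanInt_nonneg ((1 / 2 : ℝ) • (A (v m) + A (v n))) (A (v m))
    have hb2 := bregmanInt_nonneg ((1 / 2 : ℝ) • (A (v m) + A (v n))) (A (v n))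
    -- The loads cancel at the midpoint, so the sum equals the two energies minus twice the midpoint
    -- energy, at most `2(I + η/2) - 2I`.
    have hsum : bregmanInt ((1 / 2 : ℝ) • (A (v m) + A (v n))) (A (v m)) +
        bregmanInt ((1 / 2 : ℝ) • (A (v m) + A (v n))) (A (v n)) ≤ η := by
      have h1 := hsmall m hm
      have h2 := hsmall n hn
      simp only [dualEnergy, map_smul, map_add, smul_eq_mul] at hE h1 h2
      linarith
    have hmB : ‖(1 / 2 : ℝ) • (A (v m) + A (v n))‖ ^ p ≤ B := by
      have h1 : ‖(1 / 2 : ℝ) • (A (v m) + A (v n))‖ ≤ max ‖A (v m)‖ ‖A (v n)‖ := by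
        rw [norm_smul, norm_of_nonneg (by norm_num)]
        have := norm_add_le (A (v m)) (A (v n))
        linarith [le_max_left ‖A (v m)‖ ‖A (v n)‖, le_max_right ‖A (v m)‖ ‖A (v n)‖]
      refine (rpow_le_rpow (norm_nonneg _) h1 hp0.le).trans ?_
      rcases max_choice ‖A (v m)‖ ‖A (v n)‖ with h | h <;> rw [h]
      · exact hvB m
      · exact hvB n
    have hd1 := hH _ _ hmB (hvB m) (by linarith)
    have hd2 := hH _ _ hmB (hvB n) (by linarith)
    have hd : ‖A (v m) - A (v n)‖ < ε / (C + 1) := by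
      have := norm_sub_le_norm_sub_add_norm_sub (A (v m)) ((1 / 2 : ℝ) • (A (v m) + A (v n)))
        (A (v n))
      rw [norm_sub_rev ((1 / 2 : ℝ) • (A (v m) + A (v n))) (A (v n))] at this
      have e : ε / (C + 1) = ε / (2 * (C + 1)) + ε / (2 * (C + 1)) := by field_simp; norm_num
      linarith
    rw [dist_eq_norm]
    calc ‖v m - v n‖ ≤ C * ‖A (v m - v n)‖ := hA _
      _ ≤ (C + 1) * ‖A (v m - v n)‖ := by gcongr; linarith
      _ < (C + 1) * (ε / (C + 1)) := by
          rw [map_sub]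
          exact mul_lt_mul_of_pos_left hd (by positivity)
      _ = ε := by field_simp
  obtain ⟨u, hu⟩ := cauchySeq_tendsto_of_complete hcau
  have hcont : Continuous (dualEnergy A ℓ) := by
    unfold dualEnergy
    exact (continuous_const.mul (A.continuous.norm.rpow_const fun _ => Or.inr hp0.le)).sub
      ℓ.continuous
  have hmin : dualEnergy A ℓ u ≤ I := by
    have h1 := (hcont.tendsto u).comp hu
    have h2 : Tendsto (fun n : ℕ => I + 1 / ((n : ℝ) + 1)) atTop (𝓝 (I + 0)) :=
      tendsto_one_div_add_atTop_nhds_zero_nat.const_add I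
    rw [add_zero] at h2
    exact le_of_tendsto_of_tendsto' h1 h2 fun n => (hv n).le
  have hu' : ∀ v, dualEnergy A ℓ u ≤ dualEnergy A ℓ v := fun v => hmin.trans (hle v)
  refine ⟨u, hu', fun w hw => ?_⟩
  have h := dualEnergy_sub_eq A hu' w
  have h0 : A w = A u := eq_of_bregmanInt_le_zero (h ▸ sub_nonpos.2 (hw u))
  have h1 := hA (w - u)
  rw [map_sub, h0, sub_self, norm_zero, mul_zero] at h1
  exact sub_eq_zero.1 (norm_le_zero_iff.1 h1)

/-- The solution operator is continuous. -/
lemma exists_continuous_solution [CompleteSpace X] {C : ℝ} (hC : 0 ≤ C)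
    (hA : ∀ v, ‖v‖ ≤ C * ‖A v‖) :
    ∃ S : (X →L[ℝ] ℝ) → X, Continuous S ∧ ∀ ℓ, IsUniqueMinimizer (dualEnergy A ℓ) (S ℓ) := by
  choose S hS using exists_isUniqueMinimizer_dualEnergy A hC hA
  refine ⟨S, ?_, hS⟩
  have hp1 : 1 < p := hp.out
  have hp0 : 0 < p := by linarith
  have hpq := Real.HolderConjugate.conjExponent hp1
  obtain ⟨K, hK, hco⟩ := exists_norm_rpow_le_dualEnergy A hpq hC hA
  have hSb : ∀ ℓ, ‖A (S ℓ)‖ ^ p ≤ K * ‖ℓ‖ ^ p.conjExponent := fun ℓ => by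
    have h1 := hco ℓ (S ℓ)
    have h2 := (hS ℓ).1 0
    have e : dualEnergy A ℓ 0 = 0 := by
      rw [dualEnergy, map_zero, map_zero, norm_zero, zero_rpow hp0.ne']
      ring
    rw [e] at h2
    have h3 : 2 * p * dualEnergy A ℓ (S ℓ) ≤ 0 :=
      mul_nonpos_of_nonneg_of_nonpos (by positivity) h2
    linarith
  rw [Metric.continuous_iff]
  intro ℓ ε hε
  set B := K * (‖ℓ‖ + 1) ^ p.conjExponent with hB
  have hB0 : 0 ≤ B := by positivity
  set M := C * B ^ (1 / p) with hM
  have hM0 : 0 ≤ M := by positivity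
  have hSB : ∀ ℓ' : X →L[ℝ] ℝ, ‖ℓ'‖ ≤ ‖ℓ‖ + 1 → ‖A (S ℓ')‖ ^ p ≤ B := fun ℓ' h =>
    (hSb ℓ').trans (mul_le_mul_of_nonneg_left
      (rpow_le_rpow (norm_nonneg _) h hpq.symm.nonneg) hK)
  have hSM : ∀ ℓ' : X →L[ℝ] ℝ, ‖ℓ'‖ ≤ ‖ℓ‖ + 1 → ‖S ℓ'‖ ≤ M := fun ℓ' h => by
    refine (hA _).trans (mul_le_mul_of_nonneg_left ?_ hC)
    refine (rpow_le_rpow_iff (norm_nonneg _) (by positivity) hp0).1 ((hSB ℓ' h).trans_eq ?_)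
    rw [← rpow_mul hB0, one_div_mul_cancel hp0.ne', rpow_one]
  obtain ⟨η, hη, hH⟩ := exists_norm_sub_lt_of_bregmanInt (μ := μ) (d := d) (p := p) B
    (δ := ε / (C + 1)) (by positivity)
  -- The bound 1 keeps `ℓ'` in the ball where `B` and `M` control the solutions; the `+ 1` keeps the
  -- denominator positive.
  refine ⟨min 1 (η / (2 * M + 1)), by positivity, fun ℓ' hℓ' => ?_⟩
  rw [dist_eq_norm] at hℓ' ⊢
  have h1 : ‖ℓ' - ℓ‖ ≤ 1 := hℓ'.le.trans (min_le_left _ _)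
  have h2 : ‖ℓ' - ℓ‖ ≤ η / (2 * M + 1) := hℓ'.le.trans (min_le_right _ _)
  have h3 : ‖ℓ'‖ ≤ ‖ℓ‖ + 1 := by
    have := norm_le_norm_add_norm_sub' ℓ' ℓ
    linarith
  have h4 : ‖ℓ‖ ≤ ‖ℓ‖ + 1 := by linarith
  have hgap := dualEnergy_sub_eq A (hS ℓ).1 (S ℓ')
  -- Minimality of `S ℓ'` for the load `ℓ'` leaves only the change of load.
  have hgap' : dualEnergy A ℓ (S ℓ') - dualEnergy A ℓ (S ℓ) ≤ (ℓ' - ℓ) (S ℓ' - S ℓ) := by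
    have := (hS ℓ').1 (S ℓ)
    simp only [dualEnergy, sub_apply, map_sub] at this ⊢
    linarith
  have hsmall : bregmanInt (A (S ℓ)) (A (S ℓ')) ≤ η := by
    rw [← hgap]
    refine hgap'.trans ((le_norm_self _).trans (((ℓ' - ℓ).le_opNorm _).trans ?_))
    have h5 : ‖S ℓ' - S ℓ‖ ≤ 2 * M + 1 :=
      (norm_sub_le _ _).trans (by linarith [hSM ℓ' h3, hSM ℓ h4])
    calc ‖ℓ' - ℓ‖ * ‖S ℓ' - S ℓ‖ ≤ η / (2 * M + 1) * (2 * M + 1) := by gcongr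
      _ = η := by field_simp
  have hlt := hH _ _ (hSB ℓ h4) (hSB ℓ' h3) hsmall
  calc ‖S ℓ' - S ℓ‖ ≤ C * ‖A (S ℓ' - S ℓ)‖ := hA _
    _ ≤ (C + 1) * ‖A (S ℓ' - S ℓ)‖ := by gcongr; linarith
    _ < (C + 1) * (ε / (C + 1)) := by
        rw [map_sub]
        exact mul_lt_mul_of_pos_left hlt (by positivity)
    _ = ε := by field_simp

end Minimization

/-! ### Slices of `L^q` functions on a product. -/

section Slices

open Filter

/-- A map into a separable metric space is measurable if its distances to points are. -/
lemma stronglyMeasurable_of_dist {β X : Type*} [MeasurableSpace β] [PseudoMetricSpace X]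
    [SecondCountableTopology X] {G : β → X} (h : ∀ a, Measurable fun y => dist (G y) a) :
    StronglyMeasurable G := by
  borelize X
  refine Measurable.stronglyMeasurable (measurable_of_isOpen fun U hU => ?_)
  have hr : ∀ a : U, ∃ r > 0, Metric.ball (a : X) r ⊆ U := fun a =>
    Metric.isOpen_iff.1 hU a a.2
  choose r hr0 hrU using hr
  obtain ⟨T, hT, hTU⟩ := isOpen_iUnion_countable (fun a : U => Metric.ball (a : X) (r a))
    fun a => Metric.isOpen_ball
  have hU' : U = ⋃ a ∈ T, Metric.ball (a : X) (r a) := by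
    rw [hTU]
    exact Set.Subset.antisymm
      (fun x hx => Set.mem_iUnion.2 ⟨⟨x, hx⟩, Metric.mem_ball_self (hr0 _)⟩)
      (Set.iUnion_subset hrU)
  rw [hU', Set.preimage_iUnion₂]
  exact MeasurableSet.biUnion hT fun a _ => measurableSet_lt (h a) measurable_const

variable {β α : Type*} [MeasurableSpace β] [MeasurableSpace α] {ν : Measure β} {μ : Measure α}
  [SFinite μ]

/-- A function in `L^q` of a product has a measurable representative all of whose slices are
in `L^q`. -/
lemma exists_stronglyMeasurable_memLp_slices [SFinite ν] {q : ℝ} (hq : 0 < q)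
    {f : β × α → ℝ} (hf : MemLp f (ENNReal.ofReal q) (ν.prod μ)) :
    ∃ g : β × α → ℝ, StronglyMeasurable g ∧
      (∀ y, MemLp (fun x => g (y, x)) (ENNReal.ofReal q) μ) ∧
      ∀ᵐ y ∂ν, (fun x => g (y, x)) =ᵐ[μ] fun x => f (y, x) := by
  have hqe : ENNReal.ofReal q ≠ 0 := by simpa using hq
  obtain ⟨f₀, hm₀, hae₀⟩ := hf.1
  have hs : MeasurableSet {y | Integrable (fun x => ‖f₀ (y, x)‖ ^ q) μ} :=
    measurableSet_integrable (f := fun y x => ‖f₀ (y, x)‖ ^ q)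
      (hm₀.norm.measurable.pow_const q).stronglyMeasurable
  have hsae : ∀ᵐ y ∂ν, Integrable (fun x => ‖f₀ (y, x)‖ ^ q) μ :=
    (integrable_norm_rpow_of_memLp hq ((memLp_congr_ae hae₀).1 hf)).prod_right_ae
  -- Slices outside `L^q`, which occur only for a null set of `y`, are set to zero so that every
  -- slice defines an element of `L^q`.
  refine ⟨(Prod.fst ⁻¹' {y | Integrable (fun x => ‖f₀ (y, x)‖ ^ q) μ}).indicator f₀,
    hm₀.indicator (measurable_fst hs), fun y => ?_, ?_⟩
  · by_cases hy : Integrable (fun x => ‖f₀ (y, x)‖ ^ q) μ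
    · simp only [Set.indicator, Set.mem_preimage, Set.mem_ofPred_eq, hy, if_true]
      have hm : StronglyMeasurable fun x => f₀ (y, x) :=
        hm₀.comp_measurable measurable_prodMk_left
      rw [← integrable_norm_rpow_iff hm.aestronglyMeasurable hqe ENNReal.ofReal_ne_top, ENNReal.toReal_ofReal hq.le]
      exact hy
    · simp only [Set.indicator, Set.mem_preimage, Set.mem_ofPred_eq, hy, if_false]
      exact MemLp.zero'
  · filter_upwards [hsae, Measure.ae_ae_of_ae_prod hae₀] with y hy hy'
    filter_upwards [hy'] with x hx
    simp only [Set.indicator, Set.mem_preimage, Set.mem_ofPred_eq, hy, if_true, hx]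

/-- The space `L^q` is separable, and the distance from the slice to a fixed `h` is a parametric
integral, measurable by Tonelli. -/
lemma stronglyMeasurable_toLp_slices [MeasurableSpace.CountablyGenerated α] {q : ℝ}
    [hq : Fact (1 < q)] {g : β × α → ℝ} (hg : StronglyMeasurable g)
    (hmem : ∀ y, MemLp (fun x => g (y, x)) (ENNReal.ofReal q) μ) :
    StronglyMeasurable fun y => (hmem y).toLp := by
  have hq0 : 0 < q := zero_lt_one.trans hq.out
  have : Fact (ENNReal.ofReal q ≠ ∞) := ⟨ENNReal.ofReal_ne_top⟩
  refine stronglyMeasurable_of_dist fun h => ?_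
  have hd : ∀ y, dist (hmem y).toLp h =
      ((∫⁻ x, ‖g (y, x) - h x‖ₑ ^ q ∂μ) ^ (1 / q)).toReal := by
    intro y
    rw [Lp.dist_def, eLpNorm_congr_ae ((hmem y).coeFn_toLp.sub (EventuallyEq.refl _ _)),
      eLpNorm_eq_lintegral_rpow_enorm_toReal (by simpa using hq0) ENNReal.ofReal_ne_top,
      ENNReal.toReal_ofReal hq0.le]
    rfl
  simp_rw [hd]
  have hjoint : Measurable fun z : β × α => ‖g z - h z.2‖ₑ ^ q :=
    ((hg.sub ((Lp.stronglyMeasurable h).comp_measurable measurable_snd)).enorm).pow_const q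
  exact (hjoint.lintegral_prod_right'.pow_const _).ennreal_toReal

/-- The slices of a function in `L^q` of a product form a strongly measurable map into `L^q`. -/
lemma exists_slice [SFinite ν] [MeasurableSpace.CountablyGenerated α]
    {q : ℝ} [hq : Fact (1 < q)] {f : β × α → ℝ} (hf : MemLp f (ENNReal.ofReal q) (ν.prod μ)) :
    ∃ G : β → Lp ℝ (ENNReal.ofReal q) μ, AEStronglyMeasurable G ν ∧
      (∀ᵐ y ∂ν, G y =ᵐ[μ] fun x => f (y, x)) ∧ Integrable (fun y => ‖G y‖ ^ q) ν := by
  have hq0 : 0 < q := zero_lt_one.trans hq.out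
  obtain ⟨g, hg, hmem, hae⟩ := exists_stronglyMeasurable_memLp_slices hq0 hf
  have hslice : ∀ᵐ y ∂ν, (hmem y).toLp =ᵐ[μ] fun x => f (y, x) :=
    hae.mono fun y hy => (hmem y).coeFn_toLp.trans hy
  refine ⟨fun y => (hmem y).toLp, (stronglyMeasurable_toLp_slices hg hmem).aestronglyMeasurable,
    hslice, ?_⟩
  refine (integrable_norm_rpow_of_memLp hq0 hf).integral_prod_left.congr ?_
  filter_upwards [hslice] with y hy
  rw [Lp_norm_rpow hq0]
  refine integral_congr_ae ?_
  filter_upwards [hy] with x hx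
  rw [hx]

end Slices

/-! ### From slices to the parametric problem. -/

section Main

variable {d N : ℕ} {p q : ℝ} [hp : Fact (1 < p)] [hq : Fact (1 < q)] {Ω : Opens (Space d)}
  {P : Opens (Space N)}

variable (Ω) in
/-- The functional `v ↦ ∫_Ω g v` on `W_0^{1,p}(Ω)`, as a continuous linear function of `g`. -/
def loadL (hpq : p.HolderConjugate q) :
    Lp ℝ (ENNReal.ofReal q) (volume.restrict (Ω : Set (Space d))) →L[ℝ]
      (SobolevZero Ω (ENNReal.ofReal p) →L[ℝ] ℝ) :=
  haveI := hpq.symm.ennrealOfReal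
  ((funL Ω (ENNReal.ofReal p)).precomp ℝ).comp
    ((ContinuousLinearMap.mul ℝ ℝ).lpPairing (volume.restrict (Ω : Set (Space d)))
      (ENNReal.ofReal q) (ENNReal.ofReal p))

lemma loadL_apply (hpq : p.HolderConjugate q)
    (g : Lp ℝ (ENNReal.ofReal q) (volume.restrict (Ω : Set (Space d))))
    (v : SobolevZero Ω (ENNReal.ofReal p)) :
    loadL Ω hpq g v = ∫ x in Ω, g x * v.toFun x :=
  haveI := hpq.symm.ennrealOfReal
  ContinuousLinearMap.lpPairing_eq_integral _ _ _

lemma energy_eq_dualEnergy (hpq : p.HolderConjugate q)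
    {g : Lp ℝ (ENNReal.ofReal q) (volume.restrict (Ω : Set (Space d)))} {f : Space d → ℝ}
    (h : g =ᵐ[volume.restrict (Ω : Set (Space d))] f) :
    energy p Ω f = dualEnergy (gradL Ω (ENNReal.ofReal p)) (loadL Ω hpq g) := by
  funext v
  rw [energy, dualEnergy, loadL_apply, Lp_norm_rpow hpq.pos]
  congr 1
  refine integral_congr_ae ?_
  filter_upwards [h] with x hx
  rw [hx]

lemma integrable_dualEnergy_slices (hpq : p.HolderConjugate q)
    {G : Space N → Lp ℝ (ENNReal.ofReal q) (volume.restrict (Ω : Set (Space d)))}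
    (hG : AEStronglyMeasurable G (volume.restrict (P : Set (Space N))))
    (hGi : Integrable (fun y => ‖G y‖ ^ q) (volume.restrict (P : Set (Space N))))
    (v : ParamSpace p Ω P) :
    Integrable (fun y => dualEnergy (gradL Ω (ENNReal.ofReal p)) (loadL Ω hpq (G y)) (v y))
      (volume.restrict (P : Set (Space N))) := by
  have hv := (Lp.memLp v).1
  have hvi := integrable_norm_rpow_of_memLp hpq.pos (Lp.memLp v)
  refine Integrable.sub ?_ ?_
  -- The energy splits into a gradient term, the `p`-th power of an `L^p` function, and a load term,
  -- controlled by Young's inequality.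
  · have hA : MemLp (fun y => gradL Ω (ENNReal.ofReal p) (v y)) (ENNReal.ofReal p)
        (volume.restrict (P : Set (Space N))) :=
      (gradL Ω (ENNReal.ofReal p)).comp_memLp' (Lp.memLp v)
    exact (integrable_norm_rpow_of_memLp hpq.pos hA).const_mul (1 / p)
  · refine ((hvi.add (hGi.const_mul (‖loadL Ω hpq‖ ^ q))).mono' ?_ (.of_forall fun y => ?_))
    · exact (isBoundedBilinearMap_apply (𝕜 := ℝ) (E := SobolevZero Ω (ENNReal.ofReal p))
        (F := ℝ)).continuous.comp_aestronglyMeasurable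
          (((loadL Ω hpq).continuous.comp_aestronglyMeasurable hG).prodMk hv)
    · have h1 : ‖loadL Ω hpq (G y) (v y)‖ ≤ ‖v y‖ * (‖loadL Ω hpq‖ * ‖G y‖) := by
        calc _ ≤ ‖loadL Ω hpq (G y)‖ * ‖v y‖ := (loadL Ω hpq (G y)).le_opNorm _
          _ ≤ (‖loadL Ω hpq‖ * ‖G y‖) * ‖v y‖ := by
              gcongr
              exact (loadL Ω hpq).le_opNorm _
          _ = _ := mul_comm _ _
      have h2 := Real.young_inequality_of_nonneg (norm_nonneg (v y))
        (by positivity : 0 ≤ ‖loadL Ω hpq‖ * ‖G y‖) hpq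
      have h3 : ‖v y‖ ^ p / p ≤ ‖v y‖ ^ p := div_le_self (by positivity) hpq.lt.le
      have h4 : (‖loadL Ω hpq‖ * ‖G y‖) ^ q / q ≤ (‖loadL Ω hpq‖ * ‖G y‖) ^ q :=
        div_le_self (by positivity) hpq.symm.lt.le
      rw [Real.mul_rpow (x := ‖loadL Ω hpq‖) (y := ‖G y‖) (by positivity) (by positivity)] at h2 h4
      exact h1.trans (h2.trans (add_le_add h3 h4))

/-- The slicewise minimizers form an element of `L^p(P, W_0^{1,p}(Ω))`. -/
lemma exists_slicewise_minimizer (hd : 1 ≤ d) (hΩ : IsBoundedDomain Ω)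
    (hpq : p.HolderConjugate q)
    {G : Space N → Lp ℝ (ENNReal.ofReal q) (volume.restrict (Ω : Set (Space d)))}
    (hG : AEStronglyMeasurable G (volume.restrict (P : Set (Space N))))
    (hGi : Integrable (fun y => ‖G y‖ ^ q) (volume.restrict (P : Set (Space N)))) :
    ∃ u : ParamSpace p Ω P, ∀ᵐ y ∂volume.restrict (P : Set (Space N)),
      IsUniqueMinimizer (dualEnergy (gradL Ω (ENNReal.ofReal p)) (loadL Ω hpq (G y))) (u y) := by
  obtain ⟨C, hC, hCA⟩ := exists_norm_funL_le (p := p) hd hΩ.2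
  have hA : ∀ v, ‖v‖ ≤ (C + 1) * ‖gradL Ω (ENNReal.ofReal p) v‖ := fun v => by
    rw [norm_eq_add, add_mul, one_mul]
    exact add_le_add_left (hCA v) _
  have hC1 : 0 ≤ C + 1 := by linarith
  obtain ⟨S, hS, hSm⟩ := exists_continuous_solution _ hC1 hA
  obtain ⟨K, hK, hco⟩ := exists_norm_rpow_le_dualEnergy _ hpq hC1 hA
  have hp0 : 0 < p := hpq.pos
  have hm : AEStronglyMeasurable (fun y => S (loadL Ω hpq (G y)))
      (volume.restrict (P : Set (Space N))) :=
    (hS.comp (loadL Ω hpq).continuous).comp_aestronglyMeasurable hG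
  have hu : MemLp (fun y => S (loadL Ω hpq (G y))) (ENNReal.ofReal p)
      (volume.restrict (P : Set (Space N))) := by
    rw [← integrable_norm_rpow_iff hm (by simpa using hp0) ENNReal.ofReal_ne_top,
      ENNReal.toReal_ofReal hp0.le]
    -- Comparison with the competitor 0 gives `E(S ℓ) ≤ 0`; coercivity then bounds `‖S ℓ‖^p` by a
    -- multiple of `‖ℓ‖^q`.
    refine (hGi.const_mul ((C + 1) ^ p * (K * ‖loadL Ω hpq‖ ^ q))).mono'
      (hm.norm.aemeasurable.pow_const p).aestronglyMeasurable (.of_forall fun y => ?_)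
    rw [Real.norm_of_nonneg (by positivity)]
    set ℓ := loadL Ω hpq (G y)
    have h1 := hco ℓ (S ℓ)
    have h2 := (hSm ℓ).1 0
    have e : dualEnergy (gradL Ω (ENNReal.ofReal p)) ℓ 0 = 0 := by
      rw [dualEnergy, map_zero, map_zero, norm_zero, Real.zero_rpow hp0.ne']
      ring
    rw [e] at h2
    have h3 : 2 * p * dualEnergy (gradL Ω (ENNReal.ofReal p)) ℓ (S ℓ) ≤ 0 :=
      mul_nonpos_of_nonneg_of_nonpos (by positivity) h2
    have h4 : ‖ℓ‖ ^ q ≤ ‖loadL Ω hpq‖ ^ q * ‖G y‖ ^ q := by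
      rw [← Real.mul_rpow (x := ‖loadL Ω hpq‖) (y := ‖G y‖) (by positivity) (by positivity)]
      exact Real.rpow_le_rpow (norm_nonneg _) ((loadL Ω hpq).le_opNorm _) hpq.symm.nonneg
    calc ‖S ℓ‖ ^ p ≤ ((C + 1) * ‖gradL Ω (ENNReal.ofReal p) (S ℓ)‖) ^ p :=
          Real.rpow_le_rpow (norm_nonneg _) (hA _) hp0.le
      _ = (C + 1) ^ p * ‖gradL Ω (ENNReal.ofReal p) (S ℓ)‖ ^ p :=
          Real.mul_rpow hC1 (norm_nonneg _)
      _ ≤ (C + 1) ^ p * (K * ‖ℓ‖ ^ q) := by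
          gcongr
          linarith
      _ ≤ (C + 1) ^ p * (K * (‖loadL Ω hpq‖ ^ q * ‖G y‖ ^ q)) := by gcongr
      _ = _ := by ring
  refine ⟨hu.toLp, ?_⟩
  filter_upwards [hu.coeFn_toLp] with y hy
  rw [hy]
  exact hSm _

/-- A slicewise unique minimizer is the unique minimizer of the integrated energy. -/
lemma isUniqueMinimizer_paramEnergy {f : Space N × Space d → ℝ} {u : ParamSpace p Ω P}
    (hint : ∀ v : ParamSpace p Ω P,
      IntegrableOn (fun y => energy p Ω (fun x => f (y, x)) (v y)) P)
    (hu : ∀ᵐ y ∂volume.restrict (P : Set (Space N)),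
      IsUniqueMinimizer (energy p Ω (fun x => f (y, x))) (u y)) :
    IsUniqueMinimizer (paramEnergy p Ω P f) u := by
  refine ⟨fun v => integral_mono_ae (hint u) (hint v) (hu.mono fun y hy => hy.1 _), ?_⟩
  intro w hw
  have hnn : 0 ≤ᵐ[volume.restrict (P : Set (Space N))] fun y =>
      energy p Ω (fun x => f (y, x)) (w y) - energy p Ω (fun x => f (y, x)) (u y) :=
    hu.mono fun y hy => sub_nonneg.2 (hy.1 _)
  have hz : ∫ y in P, (energy p Ω (fun x => f (y, x)) (w y) -
      energy p Ω (fun x => f (y, x)) (u y)) = 0 := by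
    refine le_antisymm ?_ (integral_nonneg_of_ae hnn)
    rw [integral_sub (hint w) (hint u)]
    exact sub_nonpos.2 (hw u)
  have hz' := (integral_eq_zero_iff_of_nonneg_ae hnn ((hint w).sub (hint u))).1 hz
  refine Lp.ext ?_
  filter_upwards [hz', hu] with y hy hy'
  exact hy'.2 _ fun v => (sub_eq_zero.1 hy).le.trans (hy'.1 v)

end Main

end PDirichlet

end

open PDirichlet
theorem mainTheorem9 (d : ℕ) (hd : 1 ≤ d) :
    ∃ c : ℝ → ℝ, ContinuousOn c (Set.Ioi 1) ∧ (∀ p : ℝ, 1 < p → 0 < c p) ∧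
      ∀ (p : ℝ) [Fact (1 < p)] (N : ℕ) (Ω : Opens (Space d)) (P : Opens (Space N)),
        IsBoundedDomain Ω → IsBoundedDomain P →
        ∀ f : Space N × Space d → ℝ,
          MemLp f (ENNReal.ofReal (p / (p - 1)))
            ((volume.restrict (P : Set (Space N))).prod
              (volume.restrict (Ω : Set (Space d)))) →
          -- the energies are well defined
          (∀ᵐ y ∂volume.restrict (P : Set (Space N)),
            ∀ v : SobolevZero Ω (ENNReal.ofReal p),
              IntegrableOn (fun x => f (y, x) * v.toFun x) Ω) ∧
          (∀ v : ParamSpace p Ω P,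
            IntegrableOn (fun y => energy p Ω (fun x => f (y, x)) (v y)) P) ∧
          ∃ u : ParamSpace p Ω P,
            -- (i)
            IsUniqueMinimizer (paramEnergy p Ω P f) u ∧
            -- (ii)
            (∀ᵐ y ∂volume.restrict (P : Set (Space N)),
              IsUniqueMinimizer (energy p Ω (fun x => f (y, x))) (u y)) ∧
            -- (iii)
            (∀ᵐ y ∂volume.restrict (P : Set (Space N)),
              ∀ v : SobolevZero Ω (ENNReal.ofReal p),
                (c p)⁻¹ * natDistSq p Ω v (u y)
                    ≤ energy p Ω (fun x => f (y, x)) v - energy p Ω (fun x => f (y, x)) (u y) ∧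
                energy p Ω (fun x => f (y, x)) v - energy p Ω (fun x => f (y, x)) (u y)
                    ≤ c p * natDistSq p Ω v (u y)) := by
  refine ⟨natConst, continuousOn_natConst, fun p hp => natConst_pos hp, ?_⟩
  intro p hp N Ω P hΩ _ f hf
  have hpq : p.HolderConjugate (p / (p - 1)) := Real.HolderConjugate.conjExponent hp.out
  have hq : Fact (1 < p / (p - 1)) := ⟨hpq.symm.lt⟩
  have hpq' := hpq.symm.ennrealOfReal
  obtain ⟨G, hG, hGf, hGi⟩ := exists_slice hf
  obtain ⟨u, hu⟩ := exists_slicewise_minimizer (P := P) hd hΩ hpq hG hGi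
  have hE : ∀ᵐ y ∂volume.restrict (P : Set (Space N)), energy p Ω (fun x => f (y, x)) =
      dualEnergy (gradL Ω (ENNReal.ofReal p)) (loadL Ω hpq (G y)) :=
    hGf.mono fun y hy => energy_eq_dualEnergy hpq hy
  have hint : ∀ v : ParamSpace p Ω P,
      IntegrableOn (fun y => energy p Ω (fun x => f (y, x)) (v y)) P := fun v =>
    (integrable_dualEnergy_slices hpq hG hGi v).congr (hE.mono fun y hy => by
      simp only [hy])
  have hu' : ∀ᵐ y ∂volume.restrict (P : Set (Space N)),
      IsUniqueMinimizer (energy p Ω (fun x => f (y, x))) (u y) := by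
    filter_upwards [hu, hE] with y hy hy'
    rw [hy']
    exact hy
  refine ⟨?_, hint, u, isUniqueMinimizer_paramEnergy hint hu', hu', ?_⟩
  · filter_upwards [hGf] with y hy v
    exact ((memLp_congr_ae hy).1 (Lp.memLp (G y))).integrable_mul (Lp.memLp (funL Ω _ v))
  · filter_upwards [hu, hE] with y hy hy' v
    -- The exceptional null set comes from `hu` and `hE` alone, hence serves all `v` at once.
    rw [hy', dualEnergy_sub_eq _ hy.1 v]
    exact bregmanInt_bounds _ _
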